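/- For $n\in\mathbb N$ and $p\in[0,1]$ let $\mathcal G(n,p)$ be the random graph on $\{1,\dots,n\}$ in which each of the $\binom n2$ possible edges is present independently with probability $p$. For a finite graph $G=(V,E)$, a set $S\subseteq V$ is dominating if every vertex of $G$ lies in $S$ or is adjacent to a vertex of $S$, and the domination number $D(G)$ is the smallest cardinality of a dominating set of $G$. Theorem. There is a real-valued function $\hat r=\hat r(n,p)$ with the following property. Let $p=p(n)$ be any sequence in $[0,1)$ with $\frac{\ln^2 n}{\sqrt n}=o(p(n))$ as $n\to\infty$; write $q=q(n)=\frac1{1-p(n)}$ and $d=d(n)=n\,p(n)$, and let $G\sim\mathcal G(n,p(n))$. Then there is a sequence $\varepsilon(n)\to0$ such that, for all sufficiently large $n$, \[ \hat r(n,p(n))=\log_q\!\left(\frac{n\ln q}{\ln^2 d}\,\bigl(1+\varepsilon(n)\bigr)\right), \] and \[ \Pr\Bigl[D(G)=\lfloor\hat r(n,p(n))\rfloor+1\ \text{ or }\ D(G)=\lfloor\hat r(n,p(n))\rfloor+2\Bigr]\longrightarrow 1\qquad(n\to\infty). \] -/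

import Mathlib

open Filter Topology Asymptotics MeasureTheory

namespace SimpleGraph

/-- A set `S` of vertices is dominating if every vertex is in `S` or adjacent to a member of `S`. -/
def IsDominating {V : Type*} (G : SimpleGraph V) (S : Set V) : Prop :=
  ∀ v : V, v ∈ S ∨ ∃ u ∈ S, G.Adj v u

/-- The domination number of a finite graph: the smallest cardinality of a dominating set. (The set
of cardinalities is never empty, as the whole vertex set is dominating.) -/
noncomputable def dominationNumber {V : Type*} [Fintype V] (G : SimpleGraph V) : ℕ :=
  sInf {k : ℕ | ∃ S : Finset V, S.card = k ∧ G.IsDominating (S : Set V)}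

end SimpleGraph

/-- The real number `q = 1 / (1 - p)`. -/
noncomputable def qOf (p : ℝ) : ℝ := 1 / (1 - p)

/-- The event, among graphs on the vertex set `Fin n`, that the domination number is
`⌊r⌋ + 1` or `⌊r⌋ + 2`. -/
def twoPointEvent (n : ℕ) (r : ℝ) : Set (SimpleGraph (Fin n)) :=
  {G | (G.dominationNumber : ℤ) = ⌊r⌋ + 1 ∨ (G.dominationNumber : ℤ) = ⌊r⌋ + 2}

/-! Write `L = log (np)`, `l = log q`, and let `X_r` count the dominating sets of size `r`, so that
`E X_r = C(n,r) (1 - q^{-r})^{n-r}`. Let `k` be the least `r` with `E X_r ≥ 1/L`. The domination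
number is `k` or `k + 1` with high probability, and `rhat` is a real number with floor `k - 1`.

Lower bound: `E X_{k-1} < 1/L → 0`, so Markov's inequality rules out dominating sets of size `k -
1`.

Upper bound: one more vertex multiplies the expectation by at least about `np/L`
(`expectedDominating_succ_ge`), so `E X_{k+1} ≥ e^L/(4L²)`, and Chebyshev's inequality applies once
`E X² / (E X)² → 1`. Pairs of sets are sorted by the size `s` of their intersection. `joint_pow_le`
compares the joint probability with the product, and `second_moment_term_le` shows that `s = 0`
carries the sum. The errors include `n q^{-2r}` and `r²/n`; with `n q^{-r}` of order at most `L²/p`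
and `r` at most of order `L/p`, they are controlled by `L⁴/(np²)`, which tends to 0 by the
hypothesis on `p`.

Location of `k`: with `ρ = log_q (n l / L²)`, at `r = ρ` both `log C(n,r)` and `n q^{-r}` are about
`L²/l`. Moving `r` by `δ/l` changes the second by a factor `e^{±δ}` and decides which wins
(`expectedDominating_lt`, `one_le_expectedDominating`). Hence `k` lies between `ρ - δ/l` and `ρ + 1
+ δ/l`, and clamping `ρ` into `[k-1, k)` moves it by `o(1/l)`: this is the factor `1 + ε(n)`. -/

namespace SimpleGraph

/-! ### Independence: exact probabilities of domination events. -/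

variable {V : Type*}

instance discreteMeasurableSpace_of_finite [Finite V] : DiscreteMeasurableSpace (SimpleGraph V) where
  forall_measurableSet S := by
    have h : S = edgeSet ⁻¹' (edgeSet '' S) := (Set.preimage_image_eq S edgeSet_injective).symm
    rw [h]
    exact measurable_edgeSet (Set.toFinite _).measurableSet

/-- The probability that a given finite set of potential edges is avoided. -/
theorem binomialRandom_real_forall_notMem [Finite V] (p : unitInterval) (F : Finset (Sym2 V))
    (hF : ∀ e ∈ F, ¬ e.IsDiag) :
    (binomialRandom V p).real {G | ∀ e ∈ F, e ∉ G.edgeSet} = (1 - (p : ℝ)) ^ F.card := by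
  rw [measureReal_def, binomialRandom_eq_map,
    Measure.map_apply measurable_fromEdgeSet (MeasurableSet.of_discrete),
    ProbabilityTheory.setBernoulli_apply']
  have h : (fun f : Sym2 V → Prop ↦ {i | f i}) ⁻¹'
      (fromEdgeSet ⁻¹' {G : SimpleGraph V | ∀ e ∈ F, e ∉ G.edgeSet}) =
      (F : Set (Sym2 V)).pi (fun _ ↦ {False}) := by
    ext f
    simp only [Set.mem_preimage, Set.mem_ofPred_eq, edgeSet_fromEdgeSet, Set.mem_sdiff, not_and,
      not_not, Set.mem_pi, Finset.mem_coe, Set.mem_singleton_iff, eq_iff_iff, iff_false]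
    exact forall₂_congr fun e he ↦ ⟨fun h1 h2 ↦ hF e he (h1 h2), fun h1 h2 ↦ absurd h2 h1⟩
  rw [h, Measure.infinitePi_pi _ (fun i _ ↦ MeasurableSet.of_discrete)]
  have h2 : ∀ e ∈ F, (unitInterval.toNNReal p • Measure.dirac (e ∈ (Sym2.diagSetᶜ : Set (Sym2 V)))
      + unitInterval.toNNReal (unitInterval.symm p) • Measure.dirac False) ({False} : Set Prop)
      = (unitInterval.toNNReal (unitInterval.symm p) : ENNReal) := by
    intro e he
    have : (e ∈ (Sym2.diagSetᶜ : Set (Sym2 V))) = True := by simpa using hF e he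
    rw [this]
    simp
  rw [Finset.prod_congr rfl h2]
  simp

variable [Fintype V] [DecidableEq V]

/-- Because every `N v` avoids `W`, the pairs `(v, a)` name distinct edges, so nothing is counted
twice and the probability is a product over `v`. -/
theorem binomialRandom_real_forall_not_adj (p : unitInterval) (W : Finset V) (N : W → Finset V)
    (hN : ∀ v, Disjoint (N v) W) :
    (binomialRandom V p).real {G | ∀ v : W, ∀ a ∈ N v, ¬ G.Adj v a} =
      ∏ v, (1 - (p : ℝ)) ^ (N v).card := by
  have key := binomialRandom_real_forall_notMem p
    ((Finset.univ.sigma N).image (fun x : (_ : W) × V ↦ s((x.1 : V), x.2))) (by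
      intro e he
      simp only [Finset.mem_image, Finset.mem_sigma, Finset.mem_univ, true_and] at he
      obtain ⟨⟨v, a⟩, ha, rfl⟩ := he
      simp only [Sym2.mk_isDiag_iff]
      rintro rfl
      exact Finset.disjoint_left.1 (hN v) ha v.2)
  rw [Finset.card_image_of_injOn, Finset.card_sigma, ← Finset.prod_pow_eq_pow_sum] at key
  · rw [← key]
    congr 1
    ext G
    simp only [Set.mem_ofPred_eq, Finset.mem_image, Finset.mem_sigma, Finset.mem_univ, true_and]
    constructor
    · rintro h e ⟨⟨v, a⟩, ha, rfl⟩
      exact h v a ha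
    · intro h v a ha
      exact h _ ⟨⟨v, a⟩, ha, rfl⟩
  · rintro ⟨v, a⟩ h1 ⟨w, b⟩ h2 h
    simp only [Finset.coe_sigma, Finset.coe_univ, Set.mem_sigma_iff, Set.mem_univ, true_and,
      Finset.mem_coe] at h1 h2
    simp only [Sym2.eq_iff] at h
    rcases h with ⟨h3, h4⟩ | ⟨h3, h4⟩
    · obtain rfl := Subtype.ext h3
      subst h4
      rfl
    · subst h4
      exact absurd v.2 (Finset.disjoint_left.1 (hN w) (h3 ▸ h2))

open scoped Classical in
/-- The indicator of the event that `v` has no neighbour in `A`. -/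
noncomputable def noNbr (A : Finset V) (v : V) (G : SimpleGraph V) : ℝ :=
  if ∀ a ∈ A, ¬ G.Adj v a then 1 else 0

/-- Expanding the product over choice functions `W → J` leaves only non-edge events, whose
probabilities factor. The signs `c` encode inclusion–exclusion, for one set as `(1, -1)` and for two
as `(1, -1, -1, 1)`. -/
theorem integral_prod_sum_noNbr {J : Type*} [Fintype J] (p : unitInterval) (W : Finset V)
    (A : J → Finset V) (c : J → ℝ) (hA : ∀ j, Disjoint (A j) W) :
    ∫ G, ∏ v ∈ W, ∑ j, c j * noNbr (A j) v G ∂(binomialRandom V p) =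
      (∑ j, c j * (1 - (p : ℝ)) ^ (A j).card) ^ W.card := by
  classical
  have h1 : ∀ G : SimpleGraph V, ∏ v ∈ W, ∑ j, c j * noNbr (A j) v G =
      ∑ φ : W → J, (∏ v, c (φ v)) *
        Set.indicator {G : SimpleGraph V | ∀ v : W, ∀ a ∈ A (φ v), ¬ G.Adj v a} 1 G := by
    intro G
    rw [← Finset.prod_coe_sort, Finset.prod_univ_sum, Fintype.piFinset_univ]
    refine Finset.sum_congr rfl fun φ _ ↦ ?_
    rw [Finset.prod_mul_distrib]
    congr 1
    simp only [noNbr, Finset.prod_boole, Set.indicator_apply, Set.mem_ofPred_eq, Finset.mem_univ,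
      true_imp_iff, Pi.one_apply]
  simp_rw [h1]
  rw [integral_finsetSum _ (fun _ _ ↦ Integrable.of_finite)]
  simp_rw [integral_const_mul]
  rw [← Finset.prod_const, ← Finset.prod_coe_sort, Finset.prod_univ_sum, Fintype.piFinset_univ]
  refine Finset.sum_congr rfl fun φ _ ↦ ?_
  rw [Finset.prod_mul_distrib, integral_indicator_one MeasurableSet.of_discrete,
    binomialRandom_real_forall_not_adj p W (fun v ↦ A (φ v)) (fun v ↦ hA _)]

theorem isDominating_iff (G : SimpleGraph V) (A : Finset V) :
    G.IsDominating (A : Set V) ↔ ∀ v ∈ Aᶜ, ¬ ∀ a ∈ A, ¬ G.Adj v a := by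
  unfold IsDominating
  refine forall_congr' fun v ↦ ?_
  simp only [Finset.mem_coe, Finset.mem_compl]
  push Not
  exact or_iff_not_imp_left

theorem binomialRandom_real_isDominating (p : unitInterval) (A : Finset V) :
    (binomialRandom V p).real {G | G.IsDominating (A : Set V)} =
      (1 - (1 - (p : ℝ)) ^ A.card) ^ (Fintype.card V - A.card) := by
  classical
  have key := integral_prod_sum_noNbr p Aᶜ ![∅, A] ![1, -1] (by
    intro j; fin_cases j <;> simp [disjoint_compl_right])
  simp only [Fin.sum_univ_two, Matrix.cons_val_zero, Matrix.cons_val_one, Finset.card_empty,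
    pow_zero, Finset.card_compl] at key
  rw [← integral_indicator_one MeasurableSet.of_discrete]
  convert key using 1
  · refine integral_congr_ae (.of_forall fun G ↦ ?_)
    simp only [Set.indicator_apply, Set.mem_ofPred_eq, isDominating_iff, Pi.one_apply]
    have h1 : ∀ v, (1 : ℝ) * noNbr ∅ v G + -1 * noNbr A v G =
        if ¬ ∀ a ∈ A, ¬ G.Adj v a then 1 else 0 := by
      intro v
      simp only [noNbr]
      split_ifs <;> simp_all
    simp only [h1, Finset.prod_boole]
    congr
  · ring

/-- Only vertices outside `A ∪ B` are tested, where the conditions are independent from vertex to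
vertex. Dropping the conditions on the symmetric difference turns equality into an upper bound. -/
theorem binomialRandom_real_isDominating_and_le (p : unitInterval) (A B : Finset V) :
    (binomialRandom V p).real {G | G.IsDominating (A : Set V) ∧ G.IsDominating (B : Set V)} ≤
      (1 - (1 - (p : ℝ)) ^ A.card - (1 - (p : ℝ)) ^ B.card + (1 - (p : ℝ)) ^ (A ∪ B).card) ^
        (Fintype.card V - (A ∪ B).card) := by
  classical
  have key := integral_prod_sum_noNbr p (A ∪ B)ᶜ ![∅, A, B, A ∪ B] ![1, -1, -1, 1] (by
    have h0 := disjoint_compl_right (a := A ∪ B)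
    have h1 := h0.mono_left (Finset.subset_union_left (s₁ := A) (s₂ := B))
    have h2 := h0.mono_left (Finset.subset_union_right (s₁ := A) (s₂ := B))
    intro j; fin_cases j
    · simp
    · exact h1
    · exact h2
    · exact h0)
  rw [Finset.card_compl] at key
  have hr : (1 - (1 - (p : ℝ)) ^ A.card - (1 - (p : ℝ)) ^ B.card +
      (1 - (p : ℝ)) ^ (A ∪ B).card) = ∑ j, (![1, -1, -1, 1] : Fin 4 → ℝ) j *
        (1 - (p : ℝ)) ^ ((![∅, A, B, A ∪ B] : Fin 4 → Finset V) j).card := by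
    simp [Fin.sum_univ_four]; ring
  rw [hr, ← key, ← integral_indicator_one MeasurableSet.of_discrete]
  refine integral_mono Integrable.of_finite Integrable.of_finite fun G ↦ ?_
  have h1 : ∀ v, ∑ j, (![1, -1, -1, 1] : Fin 4 → ℝ) j *
      noNbr ((![∅, A, B, A ∪ B] : Fin 4 → Finset V) j) v G =
      if (¬ ∀ a ∈ A, ¬ G.Adj v a) ∧ (¬ ∀ a ∈ B, ¬ G.Adj v a) then 1 else 0 := by
    intro v
    have h2 : noNbr (A ∪ B) v G = noNbr A v G * noNbr B v G := by
      simp only [noNbr, Finset.mem_union, or_imp, forall_and]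
      split_ifs <;> simp_all
    have h3 : noNbr ∅ v G = 1 := by simp [noNbr]
    simp only [Fin.sum_univ_four, Matrix.cons_val_zero, Matrix.cons_val_one, Matrix.cons_val]
    rw [h2, h3]
    simp only [noNbr]
    split_ifs <;> simp_all
  simp only [h1, Finset.prod_boole, Set.indicator_apply, Set.mem_ofPred_eq, isDominating_iff,
    Pi.one_apply]
  split_ifs with h4 h5
  · exact le_rfl
  · refine absurd (fun v hv ↦ ?_) h5
    simp only [Finset.mem_compl, Finset.mem_union, not_or] at hv h4
    exact ⟨h4.1 v hv.1, h4.2 v hv.2⟩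
  · exact zero_le_one
  · exact le_rfl

end SimpleGraph

/-! ### First and second moments of the number of dominating sets. -/

namespace SimpleGraph

variable {V : Type*} [Fintype V] [DecidableEq V]

omit [DecidableEq V] in
-- Supersets of dominating sets dominate, so a small dominating set can be padded to size exactly
-- `k`; hence it suffices to count sets of one size.
theorem dominationNumber_le_iff (G : SimpleGraph V) {k : ℕ} (hk : k ≤ Fintype.card V) :
    G.dominationNumber ≤ k ↔
      ∃ A ∈ Finset.powersetCard k (Finset.univ : Finset V), G.IsDominating (A : Set V) := by
  constructor
  · intro h
    have hne : {k : ℕ | ∃ S : Finset V, S.card = k ∧ G.IsDominating (S : Set V)}.Nonempty :=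
      ⟨_, Finset.univ, rfl, fun v ↦ Or.inl (by simp)⟩
    obtain ⟨S, hS, hd⟩ := Nat.sInf_mem hne
    obtain ⟨A, hSA, -, hA⟩ := Finset.exists_subsuperset_card_eq (Finset.subset_univ S)
      (n := k) (by rw [hS]; exact h) (by simpa using hk)
    refine ⟨A, by simp [Finset.mem_powersetCard, hA], fun v ↦ ?_⟩
    rcases hd v with h1 | ⟨u, h1, h2⟩
    · exact Or.inl (hSA h1)
    · exact Or.inr ⟨u, hSA h1, h2⟩
  · rintro ⟨A, hA, hd⟩
    exact Nat.sInf_le ⟨A, (Finset.mem_powersetCard.1 hA).2, hd⟩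

/-- First moment bound for the domination number. -/
theorem binomialRandom_real_dominationNumber_le (p : unitInterval) {k : ℕ}
    (hk : k ≤ Fintype.card V) :
    (binomialRandom V p).real {G | G.dominationNumber ≤ k} ≤
      (Fintype.card V).choose k * (1 - (1 - (p : ℝ)) ^ k) ^ (Fintype.card V - k) := by
  have h1 : {G : SimpleGraph V | G.dominationNumber ≤ k} =
      ⋃ A ∈ Finset.powersetCard k (Finset.univ : Finset V),
        {G : SimpleGraph V | G.IsDominating (A : Set V)} := by
    ext G
    simp only [Set.mem_ofPred_eq, dominationNumber_le_iff G hk, Set.mem_iUnion, exists_prop]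
  rw [h1]
  refine (measureReal_biUnion_finset_le _ _).trans (le_of_eq ?_)
  rw [Finset.sum_congr rfl (g := fun _ ↦ (1 - (1 - (p : ℝ)) ^ k) ^ (Fintype.card V - k))]
  · simp
  · intro A hA
    rw [binomialRandom_real_isDominating, (Finset.mem_powersetCard.1 hA).2]

theorem card_powersetCard_filter_inter_le (A : Finset V) (r s : ℕ) :
    ((Finset.powersetCard r (Finset.univ : Finset V)).filter (fun B ↦ (A ∩ B).card = s)).card ≤
      A.card.choose s * (Fintype.card V - s).choose (r - s) := by
  have h1 : (Finset.powersetCard r (Finset.univ : Finset V)).filter (fun B ↦ (A ∩ B).card = s) ⊆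
      (Finset.powersetCard s A).biUnion fun S ↦
        (Finset.powersetCard (r - s) Sᶜ).image (fun T ↦ S ∪ T) := by
    intro B hB
    simp only [Finset.mem_filter, Finset.mem_powersetCard, Finset.subset_univ, true_and] at hB
    simp only [Finset.mem_biUnion, Finset.mem_powersetCard, Finset.mem_image]
    refine ⟨A ∩ B, ⟨Finset.inter_subset_left, hB.2⟩, B \ (A ∩ B), ⟨?_, ?_⟩, ?_⟩
    · intro v hv
      simp only [Finset.mem_compl]
      exact (Finset.mem_sdiff.1 hv).2
    · rw [Finset.card_sdiff_of_subset Finset.inter_subset_right, hB.1, hB.2]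
    · exact Finset.union_sdiff_of_subset Finset.inter_subset_right
  refine (Finset.card_le_card h1).trans (Finset.card_biUnion_le.trans ?_)
  rw [← Finset.card_powersetCard, ← smul_eq_mul]
  refine Finset.sum_le_card_nsmul _ _ _ fun S hS ↦ ?_
  refine Finset.card_image_le.trans (le_of_eq ?_)
  rw [Finset.card_powersetCard, Finset.card_compl, (Finset.mem_powersetCard.1 hS).2]

/-- Second moment bound for the domination number. -/
theorem binomialRandom_real_lt_dominationNumber_mul_le (p : unitInterval) {r : ℕ}
    (hr : r ≤ Fintype.card V) :
    (binomialRandom V p).real {G | r < G.dominationNumber} *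
        ((Fintype.card V).choose r * (1 - (1 - (p : ℝ)) ^ r) ^ (Fintype.card V - r)) ^ 2 ≤
      (Fintype.card V).choose r * ∑ s ∈ Finset.range (r + 1),
        (r.choose s * (Fintype.card V - s).choose (r - s) : ℝ) *
          (1 - 2 * (1 - (p : ℝ)) ^ r + (1 - (p : ℝ)) ^ (2 * r - s)) ^
            (Fintype.card V - (2 * r - s)) -
      ((Fintype.card V).choose r * (1 - (1 - (p : ℝ)) ^ r) ^ (Fintype.card V - r)) ^ 2 := by
  classical
  set μ : ℝ := (Fintype.card V).choose r * (1 - (1 - (p : ℝ)) ^ r) ^ (Fintype.card V - r) with hμ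
  set P := binomialRandom V p
  set I : Finset V → SimpleGraph V → ℝ := fun A ↦
    Set.indicator {G : SimpleGraph V | G.IsDominating (A : Set V)} 1 with hI
  set X : SimpleGraph V → ℝ := fun G ↦
    ∑ A ∈ Finset.powersetCard r (Finset.univ : Finset V), I A G with hX
  set φ : ℕ → ℝ := fun s ↦ (1 - 2 * (1 - (p : ℝ)) ^ r + (1 - (p : ℝ)) ^ (2 * r - s)) ^
            (Fintype.card V - (2 * r - s)) with hφ
  have hp0 : 0 ≤ 1 - (p : ℝ) := by linarith [p.2.2]
  have hp1 : 1 - (p : ℝ) ≤ 1 := by linarith [p.2.1]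
  have hφ0 : ∀ s, 0 ≤ φ s := by
    intro s
    refine pow_nonneg ?_ _
    have h1 : (1 - (p : ℝ)) ^ (2 * r) ≤ (1 - (p : ℝ)) ^ (2 * r - s) :=
      pow_le_pow_of_le_one hp0 hp1 (Nat.sub_le _ _)
    rw [pow_mul'] at h1
    nlinarith [sq_nonneg (1 - (1 - (p : ℝ)) ^ r)]
  have hEX : ∫ G, X G ∂P = μ := by
    rw [hX, integral_finsetSum _ (fun _ _ ↦ Integrable.of_finite)]
    rw [Finset.sum_congr rfl (g := fun _ ↦ (1 - (1 - (p : ℝ)) ^ r) ^ (Fintype.card V - r))]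
    · simp [hμ]
    · intro A hA
      rw [hI, integral_indicator_one MeasurableSet.of_discrete, binomialRandom_real_isDominating,
        (Finset.mem_powersetCard.1 hA).2]
  have hEX2 : ∫ G, X G ^ 2 ∂P ≤ (Fintype.card V).choose r * ∑ s ∈ Finset.range (r + 1),
        (r.choose s * (Fintype.card V - s).choose (r - s) : ℝ) * φ s := by
    have h1 : ∀ G, X G ^ 2 = ∑ A ∈ Finset.powersetCard r (Finset.univ : Finset V),
        ∑ B ∈ Finset.powersetCard r (Finset.univ : Finset V),
          Set.indicator {G : SimpleGraph V | G.IsDominating (A : Set V) ∧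
            G.IsDominating (B : Set V)} 1 G := by
      intro G
      rw [sq, hX, Finset.sum_mul_sum]
      refine Finset.sum_congr rfl fun A _ ↦ Finset.sum_congr rfl fun B _ ↦ ?_
      simp only [hI, Set.indicator_apply, Set.mem_ofPred_eq, Pi.one_apply]
      split_ifs <;> simp_all
    simp_rw [h1]
    rw [integral_finsetSum _ (fun _ _ ↦ Integrable.of_finite)]
    have hcard : ((Fintype.card V).choose r : ℝ) =
        (Finset.powersetCard r (Finset.univ : Finset V)).card := by simp
    rw [hcard, ← nsmul_eq_mul]
    refine Finset.sum_le_card_nsmul _ _ _ fun A hA ↦ ?_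
    rw [integral_finsetSum _ (fun _ _ ↦ Integrable.of_finite)]
    have hAr := (Finset.mem_powersetCard.1 hA).2
    calc _ ≤ ∑ B ∈ Finset.powersetCard r (Finset.univ : Finset V), φ (A ∩ B).card := by
          refine Finset.sum_le_sum fun B hB ↦ ?_
          rw [integral_indicator_one MeasurableSet.of_discrete]
          refine (binomialRandom_real_isDominating_and_le p A B).trans (le_of_eq ?_)
          have hBr := (Finset.mem_powersetCard.1 hB).2
          have hu : (A ∪ B).card = 2 * r - (A ∩ B).card := by
            have := Finset.card_union_add_card_inter A B
            omega
          rw [hu, hAr, hBr, hφ]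
          ring
      _ = ∑ s ∈ Finset.range (r + 1), ∑ B ∈ (Finset.powersetCard r (Finset.univ : Finset V)).filter
            (fun B ↦ (A ∩ B).card = s), φ (A ∩ B).card := by
          rw [Finset.sum_fiberwise_of_maps_to]
          intro B _
          rw [Finset.mem_range, Nat.lt_succ_iff, ← hAr]
          exact Finset.card_le_card Finset.inter_subset_left
      _ ≤ _ := by
          refine Finset.sum_le_sum fun s _ ↦ ?_
          rw [Finset.sum_congr rfl (g := fun _ ↦ φ s)
            (fun B hB ↦ by rw [(Finset.mem_filter.1 hB).2]), Finset.sum_const, nsmul_eq_mul]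
          refine mul_le_mul_of_nonneg_right ?_ (hφ0 s)
          have := card_powersetCard_filter_inter_le A r s
          rw [hAr] at this
          exact_mod_cast this
  have hvar : ∫ G, (X G - μ) ^ 2 ∂P = ∫ G, X G ^ 2 ∂P - μ ^ 2 := by
    have h1 : ∀ G, (X G - μ) ^ 2 = X G ^ 2 - 2 * μ * X G + μ ^ 2 := fun G ↦ by ring
    simp_rw [h1]
    rw [integral_add Integrable.of_finite Integrable.of_finite,
      integral_sub Integrable.of_finite Integrable.of_finite, integral_const_mul, hEX]
    simp
    ring
  -- Chebyshev: on this event `X = 0`, so the squared deviation equals `μ²`.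
  have hlow : P.real {G | r < G.dominationNumber} * μ ^ 2 ≤ ∫ G, (X G - μ) ^ 2 ∂P := by
    rw [mul_comm, ← integral_indicator_one MeasurableSet.of_discrete, ← integral_const_mul]
    refine integral_mono Integrable.of_finite Integrable.of_finite fun G ↦ ?_
    simp only [Set.indicator_apply, Set.mem_ofPred_eq, Pi.one_apply]
    split_ifs with h
    · have hX0 : X G = 0 := by
        refine Finset.sum_eq_zero fun A hA ↦ ?_
        simp only [hI, Set.indicator_apply, Set.mem_ofPred_eq, Pi.one_apply, ite_eq_right_iff,
          one_ne_zero, imp_false]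
        exact fun hd ↦ absurd ((dominationNumber_le_iff G hr).2 ⟨A, hA, hd⟩) (by omega)
      rw [hX0]; simp
    · rw [mul_zero]; positivity
  linarith

end SimpleGraph

/-! ### Binomial coefficients and joint domination probabilities. -/

theorem choose_mul_pow_le_choose_mul_pow {r n : ℕ} (hrn : r ≤ n) (s : ℕ) :
    (r.choose s : ℝ) * n ^ s ≤ n.choose s * r ^ s := by
  suffices h : r.choose s * n ^ s ≤ n.choose s * r ^ s by exact_mod_cast h
  induction s with
  | zero => simp
  | succ s ih =>
    have h1 := Nat.choose_succ_right_eq r s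
    have h2 := Nat.choose_succ_right_eq n s
    have h3 : (r - s) * n ≤ (n - s) * r := by
      rw [Nat.sub_mul, Nat.sub_mul, mul_comm r n]
      exact Nat.sub_le_sub_left (Nat.mul_le_mul_left s hrn) _
    refine Nat.le_of_mul_le_mul_right ?_ (Nat.succ_pos s)
    calc r.choose (s + 1) * n ^ (s + 1) * (s + 1)
        = (r.choose (s + 1) * (s + 1)) * n ^ s * n := by ring
      _ = (r.choose s * n ^ s) * ((r - s) * n) := by rw [h1]; ring
      _ ≤ (n.choose s * r ^ s) * ((n - s) * r) := Nat.mul_le_mul ih h3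
      _ = (n.choose (s + 1) * (s + 1)) * r ^ s * r := by rw [h2]; ring
      _ = n.choose (s + 1) * r ^ (s + 1) * (s + 1) := by ring

/-- The left side bounds the chance that a random `r`-set meets a fixed one in `s` points. This form
is efficient for small overlaps; `choose_mul_choose_le` serves overlaps close to `r`. -/
theorem choose_mul_choose_div_le {r n s : ℕ} (hn : 0 < n) (hrn : r ≤ n) (hs : s ≤ r) :
    (r.choose s * (n - s).choose (r - s) : ℝ) / n.choose r ≤ ((r : ℝ) ^ 2 / n) ^ s := by
  have h1 : (n.choose r : ℝ) * r.choose s = n.choose s * (n - s).choose (r - s) := by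
    exact_mod_cast Nat.choose_mul hs
  have hc : (0 : ℝ) < n.choose r := by exact_mod_cast Nat.choose_pos hrn
  have hc' : (0 : ℝ) < n.choose s := by exact_mod_cast Nat.choose_pos (hs.trans hrn)
  have hn' : (0 : ℝ) < (n : ℝ) ^ s := by positivity
  have h2 := choose_mul_pow_le_choose_mul_pow hrn s
  have h3 : (r.choose s : ℝ) ≤ r ^ s := by exact_mod_cast Nat.choose_le_pow r s
  rw [div_le_iff₀ hc, div_pow, div_mul_eq_mul_div, le_div_iff₀ hn', ← pow_mul, mul_comm 2 s,
    pow_mul]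
  have h0 : (0 : ℝ) ≤ (r.choose s : ℝ) := by positivity
  refine le_of_mul_le_mul_left ?_ hc'
  calc (n.choose s : ℝ) * (r.choose s * (n - s).choose (r - s) * n ^ s)
      = r.choose s * (n.choose s * (n - s).choose (r - s)) * n ^ s := by ring
    _ = n.choose r * r.choose s * (r.choose s * n ^ s) := by rw [← h1]; ring
    _ ≤ n.choose r * r ^ s * (n.choose s * r ^ s) := by gcongr
    _ = n.choose s * ((r ^ s) ^ 2 * n.choose r) := by ring

theorem choose_mul_choose_le {r n s : ℕ} (hs : s ≤ r) :
    (r.choose s * (n - s).choose (r - s) : ℝ) ≤ ((r : ℝ) * n) ^ (r - s) := by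
  rw [← Nat.choose_symm hs, mul_pow]
  have h1 := Nat.choose_le_pow r (r - s)
  have h2 := (Nat.choose_le_pow (n - s) (r - s)).trans
    (Nat.pow_le_pow_left (Nat.sub_le n s) (r - s))
  exact mul_le_mul (by exact_mod_cast h1) (by exact_mod_cast h2) (by positivity) (by positivity)

/-- Comparison of the joint domination probability of two sets with the product. -/
theorem joint_pow_le {n r s : ℕ} {p : ℝ} (hp0 : 0 ≤ p) (hp1 : p ≤ 1) (hs : s ≤ r)
    (hrn : 2 * r ≤ n) (hx : (1 - p) ^ r ≤ 1 / 2) :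
    (1 - 2 * (1 - p) ^ r + (1 - p) ^ (2 * r - s)) ^ (n - (2 * r - s)) ≤
      ((1 - (1 - p) ^ r) ^ (n - r)) ^ 2 *
        (Real.exp (4 * r * (1 - p) ^ r + 6 * n * ((1 - p) ^ r) ^ 2) *
          Real.exp (n * (1 - p) ^ r * ((1 - p) ^ (r - s) - (1 - p) ^ r))) := by
  have hq0 : 0 ≤ 1 - p := by linarith
  have hq1 : 1 - p ≤ 1 := by linarith
  have hxy : (1 - p) ^ r ≤ (1 - p) ^ (r - s) := pow_le_pow_of_le_one hq0 hq1 (Nat.sub_le _ _)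
  have hy1 : (1 - p) ^ (r - s) ≤ 1 := pow_le_one₀ hq0 hq1
  have hx0 : 0 ≤ (1 - p) ^ r := pow_nonneg hq0 _
  rw [show 2 * r - s = r + (r - s) by omega, pow_add]
  set x := (1 - p) ^ r
  set y := (1 - p) ^ (r - s)
  set m := n - (r + (r - s)) with hm
  have hz : 0 ≤ x * (y - x) := mul_nonneg hx0 (by linarith)
  have hz1 : x * (y - x) ≤ x := by nlinarith
  have h1x : 0 < 1 - x := by linarith
  -- The constant 6 is the least that works on `[0, 1/2]`: equality holds at both ends.
  have hinv : 1 ≤ (1 + 6 * x) * (1 - x) ^ 2 := by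
    have h1 : (1 + 6 * x) * (1 - x) ^ 2 = 1 + x * ((1 - 2 * x) * (4 - 3 * x)) := by ring
    have h2 : 0 ≤ x * ((1 - 2 * x) * (4 - 3 * x)) :=
      mul_nonneg hx0 (mul_nonneg (by linarith) (by linarith))
    linarith
  -- The excess `x (y - x)` over `(1 - x)²` is the covariance of the events that a fixed outside
  -- vertex is missed by each of the two sets.
  have hbase : 1 - 2 * x + x * y ≤ (1 - x) ^ 2 * Real.exp (x * (y - x) * (1 + 6 * x)) := by
    have h2 := Real.add_one_le_exp (x * (y - x) * (1 + 6 * x))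
    calc 1 - 2 * x + x * y = (1 - x) ^ 2 + x * (y - x) * 1 := by ring
      _ ≤ (1 - x) ^ 2 + x * (y - x) * ((1 + 6 * x) * (1 - x) ^ 2) := by gcongr
      _ = (1 - x) ^ 2 * (x * (y - x) * (1 + 6 * x) + 1) := by ring
      _ ≤ _ := by gcongr
  have h1e : 1 ≤ (1 - x) * Real.exp (2 * x) := by
    have h2 := Real.add_one_le_exp (2 * x)
    nlinarith
  -- The `2 (r - s)` missing factors `1 - x` cost at most `e^{2x}` each.
  have hpow : (1 - x) ^ (2 * m) ≤ (1 - x) ^ (2 * (n - r)) * Real.exp (4 * r * x) := by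
    have h3 : 2 * (n - r) = 2 * m + 2 * (r - s) := by omega
    rw [h3, pow_add, mul_assoc]
    refine le_mul_of_one_le_right (by positivity) ?_
    calc (1 : ℝ) ≤ ((1 - x) * Real.exp (2 * x)) ^ (2 * (r - s)) := one_le_pow₀ h1e
      _ = (1 - x) ^ (2 * (r - s)) * Real.exp ((2 * (r - s) : ℕ) * (2 * x)) := by
        rw [mul_pow, ← Real.exp_nat_mul]
      _ ≤ _ := by
        refine mul_le_mul_of_nonneg_left (Real.exp_le_exp.2 ?_) (by positivity)
        have : ((2 * (r - s) : ℕ) : ℝ) ≤ 2 * r := by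
          exact_mod_cast Nat.mul_le_mul_left 2 (Nat.sub_le r s)
        nlinarith
  have hmn : (m : ℝ) ≤ n := by exact_mod_cast Nat.sub_le _ _
  have hb0 : 0 ≤ 1 - 2 * x + x * y := by nlinarith [sq_nonneg (1 - x)]
  calc (1 - 2 * x + x * y) ^ m
      ≤ ((1 - x) ^ 2 * Real.exp (x * (y - x) * (1 + 6 * x))) ^ m := pow_le_pow_left₀ hb0 hbase _
    _ = (1 - x) ^ (2 * m) * Real.exp (m * (x * (y - x) * (1 + 6 * x))) := by
      rw [mul_pow, ← pow_mul, ← Real.exp_nat_mul]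
    _ ≤ ((1 - x) ^ (2 * (n - r)) * Real.exp (4 * r * x)) *
          Real.exp (6 * n * x ^ 2 + n * x * (y - x)) := by
      gcongr
      have h4 : (m : ℝ) * (x * (y - x) * (1 + 6 * x)) ≤ n * (x * (y - x) * (1 + 6 * x)) := by
        gcongr
      have h5 : (n : ℝ) * (x * (y - x)) * (6 * x) ≤ n * x * (6 * x) := by gcongr
      nlinarith
    _ = _ := by
      rw [mul_comm 2 (n - r), pow_mul, mul_assoc, ← Real.exp_add, ← Real.exp_add]
      ring_nf

/-! ### The normalised second moment sum. -/

theorem exp_two_le_eight : Real.exp 2 ≤ 8 := by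
  have h3 : Real.exp 2 = Real.exp 1 * Real.exp 1 := by rw [← Real.exp_add]; norm_num
  have := Real.exp_one_lt_d9
  have h0 := Real.exp_pos 1
  rw [h3]; nlinarith

theorem exp_half_le_two : Real.exp (1 / 2) ≤ 2 := by
  have h3 : Real.exp (1 / 2) * Real.exp (1 / 2) = Real.exp 1 := by
    rw [← Real.exp_add]; norm_num
  have := Real.exp_one_lt_d9
  have h0 := Real.exp_pos (1 / 2)
  nlinarith

set_option maxHeartbeats 1600000 in
/-- Termwise estimate for the normalised second moment sum. -/
theorem second_moment_term_le {n r s : ℕ} {p l L : ℝ} (hp0 : 0 < p) (hp1 : p < 1)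
    (hl : Real.exp (-l) = 1 - p) (hl0 : 0 < l)
    (hL : 90 * (1 + 2 * Real.log L) ≤ L) (hL1 : 1 ≤ L)
    (hn : n ≠ 0) (hnL : Real.log n ≤ 2 * L) (hLn : Real.log (n * p) = L)
    (hM1 : n * (1 - p) ^ r ≤ 2 * L ^ 2 * (1 - p) / l)
    (hM2 : L ^ 2 * (1 - p) ^ 2 / (2 * l) ≤ n * (1 - p) ^ r)
    (hr1 : L - 2 * Real.log L - 1 ≤ l * r) (hr2 : r ≤ 2 * L / p) (hrn : r ≤ n)
    (hrx : r * (1 - p) ^ r ≤ 1 / 2)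
    (hE : Real.exp L / (4 * L ^ 2) ≤ n.choose r * (1 - (1 - p) ^ r) ^ (n - r))
    (hs : s ≤ r) :
    (r.choose s * (n - s).choose (r - s) : ℝ) / n.choose r *
      Real.exp (n * (1 - p) ^ r * ((1 - p) ^ (r - s) - (1 - p) ^ r)) ≤
    (32 * L ^ 2 / (n * p ^ 2)) ^ s + (9 * L ^ 2 * Real.exp (- L / 2)) ^ s +
      (1 / 2) ^ (r - s) * (8 * L ^ 2 * Real.exp (-L)) := by
  have hn0 : (0 : ℝ) < n := by positivity
  have hL0 : 0 < L := by linarith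
  have hlogL : 0 ≤ Real.log L := Real.log_nonneg hL1
  have hq0 : 0 < 1 - p := by linarith
  have hA0 : 0 ≤ (32 * L ^ 2 / (n * p ^ 2)) ^ s := by positivity
  have hB0 : 0 ≤ (9 * L ^ 2 * Real.exp (- L / 2)) ^ s := by positivity
  have hC0 : 0 ≤ (1 / 2 : ℝ) ^ (r - s) * (8 * L ^ 2 * Real.exp (-L)) := by positivity
  have hcpos : (0 : ℝ) < n.choose r := by exact_mod_cast Nat.choose_pos hrn
  have hx : (1 - p) ^ r = Real.exp (-(l * r)) := by
    rw [← hl, ← Real.exp_nat_mul]; ring_nf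
  have hy : (1 - p) ^ (r - s) = Real.exp (-(l * (r - s : ℕ))) := by
    rw [← hl, ← Real.exp_nat_mul]; ring_nf
  have hxy : (1 - p) ^ r = (1 - p) ^ (r - s) * Real.exp (-(l * s)) := by
    rw [hx, hy, ← Real.exp_add, Nat.cast_sub hs]; ring_nf
  have hN1 := choose_mul_choose_div_le (Nat.pos_of_ne_zero hn) hrn hs
  have hN2 := choose_mul_choose_le (n := n) hs
  set x := (1 - p) ^ r with hxdef
  set y := (1 - p) ^ (r - s) with hydef
  have hx0 : 0 < x := pow_pos hq0 _
  have hy0 : 0 < y := pow_pos hq0 _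
  have hy1 : y ≤ 1 := pow_le_one₀ hq0.le (by linarith)
  set N : ℝ := (r.choose s * (n - s).choose (r - s) : ℝ) with hN
  have hNnn : 0 ≤ N := by positivity
  have hsq : (r : ℝ) ^ 2 / n ≤ 4 * L ^ 2 / (n * p ^ 2) := by
    have : (r : ℝ) ^ 2 ≤ (2 * L / p) ^ 2 := by gcongr
    calc (r : ℝ) ^ 2 / n ≤ (2 * L / p) ^ 2 / n := by gcongr
      _ = _ := by field_simp; ring
  have hlam : n * x * (y - x) ≤ n * x * y := by nlinarith [mul_pos (mul_pos hn0 hx0) hx0]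
  -- Since `n x ≤ 2 L² (1 - p)/l` and `y - x ≤ y l s`, the exponent is at most `2 y L² s`; when `y
  -- L² ≤ 1` it costs only `e²` per common vertex.
  by_cases hyL : y * L ^ 2 ≤ 1
  · -- few common vertices
    have h1 : n * x * (y - x) ≤ s * 2 := by
      have h2 : 1 - Real.exp (-(l * s)) ≤ l * s := by
        have := Real.add_one_le_exp (-(l * s)); linarith
      have hls : 0 ≤ l * s := by positivity
      have hnn : 0 ≤ y * (1 - Real.exp (-(l * s))) := by
        refine mul_nonneg hy0.le ?_
        have := Real.exp_le_one_iff.2 (neg_nonpos.2 hls)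
        linarith
      calc n * x * (y - x) = n * x * (y * (1 - Real.exp (-(l * s)))) := by
            rw [mul_sub y, ← hxy, mul_one]
        _ ≤ (2 * L ^ 2 * (1 - p) / l) * (y * (l * s)) := by gcongr
        _ = 2 * (1 - p) * (y * L ^ 2) * s := by field_simp
        _ ≤ 2 * 1 * 1 * s := by
          gcongr
          linarith
        _ = s * 2 := by ring
    have he2 := exp_two_le_eight
    have : N / n.choose r * Real.exp (n * x * (y - x)) ≤ (32 * L ^ 2 / (n * p ^ 2)) ^ s := by
      calc N / n.choose r * Real.exp (n * x * (y - x))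
          ≤ ((r : ℝ) ^ 2 / n) ^ s * Real.exp (s * 2) := by gcongr
        _ = ((r : ℝ) ^ 2 / n * Real.exp 2) ^ s := by rw [mul_pow, ← Real.exp_nat_mul]
        _ ≤ (4 * L ^ 2 / (n * p ^ 2) * 8) ^ s := by gcongr
        _ = _ := by ring_nf
    linarith
  · push Not at hyL
    have hu : l * (r - s : ℕ) ≤ 2 * Real.log L := by
      have h1 : 0 < Real.log (y * L ^ 2) := Real.log_pos hyL
      have hlogy : Real.log y = -(l * (r - s : ℕ)) := by rw [hy, Real.log_exp]
      rw [Real.log_mul hy0.ne' (by positivity), hlogy, Real.log_pow] at h1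
      push_cast at h1 ⊢
      linarith
    -- The lower bound `hM2` on `n x` loses `(1 - p)²`, which is useless for `p` near 1. In that
    -- range `s < r` already gives `y ≤ 1 - p`, and this gain suffices.
    by_cases hcase : 1 ≤ r - s ∧ 1 - p ≤ 1 / 3
    · -- large edge probability
      obtain ⟨hrs, hp3⟩ := hcase
      have hy2 : y ≤ 1 - p := by
        calc y ≤ (1 - p) ^ 1 := pow_le_pow_of_le_one hq0.le (by linarith) hrs
          _ = 1 - p := pow_one _
      have hls : L / 2 ≤ l * s := by
        rw [Nat.cast_sub hs] at hu
        nlinarith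
      have h1 : n * x * y ≤ s * (L / 2) := by
        calc n * x * y ≤ (2 * L ^ 2 * (1 - p) / l) * (1 - p) := by gcongr
          _ ≤ (2 * L ^ 2 * (1 / 3) / l) * (1 / 3) := by gcongr
          _ = (4 / 9 * L / l) * (L / 2) := by field_simp; ring
          _ ≤ (4 / 9 * L / l) * (l * s) := by gcongr
          _ = s * (4 / 9 * L) := by field_simp
          _ ≤ s * (L / 2) := by gcongr; linarith
      have hp2 : 2 / 3 ≤ p := by linarith
      have hr3 : (r : ℝ) ≤ 3 * L := by
        refine hr2.trans ?_
        rw [div_le_iff₀ hp0]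
        nlinarith
      have hnL' : Real.exp L ≤ n := by
        rw [← hLn, Real.exp_log (by positivity)]
        nlinarith
      have : N / n.choose r * Real.exp (n * x * (y - x)) ≤
          (9 * L ^ 2 * Real.exp (- L / 2)) ^ s := by
        calc N / n.choose r * Real.exp (n * x * (y - x))
            ≤ ((r : ℝ) ^ 2 / n) ^ s * Real.exp (s * (L / 2)) :=
              mul_le_mul hN1 (Real.exp_le_exp.2 (hlam.trans h1)) (Real.exp_pos _).le
                (by positivity)
          _ = ((r : ℝ) ^ 2 / n * Real.exp (L / 2)) ^ s := by rw [mul_pow, ← Real.exp_nat_mul]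
          _ ≤ ((3 * L) ^ 2 / Real.exp L * Real.exp (L / 2)) ^ s := by gcongr
          _ = _ := by
            congr 1
            have : Real.exp (-L / 2) = Real.exp (L / 2) / Real.exp L := by
              rw [← Real.exp_sub]; ring_nf
            rw [this]
            ring
      linarith
    · -- many common vertices
      set u := r - s
      have hx1 : x ≤ 1 := pow_le_one₀ hq0.le (by linarith)
      have hpow : (1 - x) ^ (n - r) ≤ Real.exp (-(n * x) + 1 / 2) := by
        have h1 : 1 - x ≤ Real.exp (-x) := by have := Real.add_one_le_exp (-x); linarith
        calc (1 - x) ^ (n - r) ≤ Real.exp (-x) ^ (n - r) :=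
              pow_le_pow_left₀ (by linarith) h1 _
          _ = Real.exp ((n - r : ℕ) * (-x)) := by rw [Real.exp_nat_mul]
          _ ≤ _ := by
            rw [Nat.cast_sub hrn]
            gcongr
            linarith
      have hhalf := exp_half_le_two
      -- The lower bound `hE` on the expectation, solved for the binomial coefficient: nearly equal
      -- sets are harmless because many dominating sets are expected.
      have hinv : 1 / (n.choose r : ℝ) ≤
          Real.exp (-(n * x)) * (8 * L ^ 2 * Real.exp (-L)) := by
        have hE' : Real.exp L / (4 * L ^ 2) ≤ n.choose r * (Real.exp (-(n * x)) * 2) := by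
          refine hE.trans ?_
          gcongr
          refine hpow.trans ?_
          rw [Real.exp_add]
          gcongr
        rw [div_le_iff₀ hcpos]
        rw [div_le_iff₀ (by positivity)] at hE'
        rw [Real.exp_neg L]
        have := Real.exp_pos L
        calc 1 = Real.exp L / Real.exp L := by field_simp
          _ ≤ (n.choose r * (Real.exp (-(n * x)) * 2) * (4 * L ^ 2)) / Real.exp L := by gcongr
          _ = _ := by field_simp; ring
      have hmain : ((r : ℝ) * n) ^ u * Real.exp (-(n * x) * (1 - y)) ≤ (1 / 2) ^ u := by
        rcases Nat.eq_zero_or_pos u with h0 | hpos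
        · have hy1' : y = 1 := by rw [hydef, h0, pow_zero]
          simp [h0, hy1']
        · have hp3 : 1 / 3 < 1 - p := by
            by_contra hcon
            exact hcase ⟨hpos, not_lt.1 hcon⟩
          have hM3 : L ^ 2 / (18 * l) ≤ n * x := by
            refine le_trans ?_ hM2
            rw [div_le_div_iff₀ (by positivity) (by positivity)]
            have h9 : 1 / 9 ≤ (1 - p) ^ 2 := by nlinarith
            have : 0 ≤ L ^ 2 * l := by positivity
            nlinarith
          have hyu : l * u / (1 + 2 * Real.log L) ≤ 1 - y := by
            rw [hy]
            have h1 := Real.add_one_le_exp (l * u)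
            have hlu : 0 ≤ l * u := by positivity
            have h2 : Real.exp (-(l * u)) ≤ 1 / (1 + l * u) := by
              rw [Real.exp_neg, ← one_div]
              exact one_div_le_one_div_of_le (by linarith) (by linarith)
            have h3 : l * u / (1 + 2 * Real.log L) ≤ l * u / (1 + l * u) := by gcongr
            have h4 : l * u / (1 + l * u) = 1 - 1 / (1 + l * u) := by field_simp; ring
            linarith
          -- The constant in `hL` is `90 = 18 · 5`. The rate `5L` per differing vertex beats `r n ≤
          -- e^{4L}` and leaves `e^{-L} ≤ 1/2`.
          have h5' : 5 * L ≤ L / 18 * (L / (1 + 2 * Real.log L)) := by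
            rw [div_mul_div_comm, le_div_iff₀ (by positivity)]
            nlinarith
          have h5 : u * (5 * L) ≤ n * x * (1 - y) := by
            calc (u : ℝ) * (5 * L) ≤ u * (L / 18 * (L / (1 + 2 * Real.log L))) := by
                  gcongr
              _ = L ^ 2 / (18 * l) * (l * u / (1 + 2 * Real.log L)) := by field_simp
              _ ≤ _ := by gcongr
          have h6 : (r : ℝ) * n ≤ Real.exp (4 * L) := by
            have h7 : (n : ℝ) ≤ Real.exp (2 * L) := by
              rw [← Real.log_le_iff_le_exp hn0]; exact hnL
            have h8 : (r : ℝ) ≤ n := by exact_mod_cast hrn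
            calc (r : ℝ) * n ≤ Real.exp (2 * L) * Real.exp (2 * L) := by
                  gcongr; exact h8.trans h7
              _ = _ := by rw [← Real.exp_add]; ring_nf
          have h9 : Real.exp (-L) ≤ 1 / 2 := by
            rw [Real.exp_neg, ← one_div]
            refine one_div_le_one_div_of_le (by norm_num) ?_
            have := Real.add_one_le_exp L
            linarith
          calc ((r : ℝ) * n) ^ u * Real.exp (-(n * x) * (1 - y))
              ≤ Real.exp (4 * L) ^ u * Real.exp (-(u * (5 * L))) := by
                gcongr
                linarith
            _ = Real.exp (-L) ^ u := by
              rw [← Real.exp_nat_mul, ← Real.exp_nat_mul, ← Real.exp_add]; ring_nf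
            _ ≤ _ := by gcongr
      have : N / n.choose r * Real.exp (n * x * (y - x)) ≤
          (1 / 2) ^ u * (8 * L ^ 2 * Real.exp (-L)) := by
        calc N / n.choose r * Real.exp (n * x * (y - x))
            = N * (1 / n.choose r) * Real.exp (n * x * (y - x)) := by ring
          _ ≤ ((r : ℝ) * n) ^ u * (Real.exp (-(n * x)) * (8 * L ^ 2 * Real.exp (-L))) *
              Real.exp (n * x * y) := by gcongr
          _ = (((r : ℝ) * n) ^ u * Real.exp (-(n * x) * (1 - y))) *
              (8 * L ^ 2 * Real.exp (-L)) := by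
            have : Real.exp (-(n * x) * (1 - y)) =
                Real.exp (-(n * x)) * Real.exp (n * x * y) := by
              rw [← Real.exp_add]; ring_nf
            rw [this]; ring
          _ ≤ _ := by gcongr
      linarith

theorem sum_range_succ_pow_le {A : ℝ} (h0 : 0 ≤ A) (h1 : A ≤ 1 / 2) (r : ℕ) :
    ∑ i ∈ Finset.range r, A ^ (i + 1) ≤ 2 * A := by
  calc ∑ i ∈ Finset.range r, A ^ (i + 1) ≤ ∑ i ∈ Finset.range r, (1 / 2) ^ i * A := by
        refine Finset.sum_le_sum fun i _ ↦ ?_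
        rw [pow_succ]
        gcongr
    _ = (∑ i ∈ Finset.range r, (1 / 2) ^ i) * A := by rw [Finset.sum_mul]
    _ ≤ 2 * A := by
      gcongr
      exact sum_geometric_two_le r

/-- The normalised second moment sum is close to one. -/
theorem second_moment_sum_le {n r : ℕ} {p l L : ℝ} (hp0 : 0 < p) (hp1 : p < 1)
    (hl : Real.exp (-l) = 1 - p) (hl0 : 0 < l)
    (hL : 90 * (1 + 2 * Real.log L) ≤ L) (hL1 : 1 ≤ L)
    (hn : n ≠ 0) (hnL : Real.log n ≤ 2 * L) (hLn : Real.log (n * p) = L)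
    (hM1 : n * (1 - p) ^ r ≤ 2 * L ^ 2 * (1 - p) / l)
    (hM2 : L ^ 2 * (1 - p) ^ 2 / (2 * l) ≤ n * (1 - p) ^ r)
    (hr1 : L - 2 * Real.log L - 1 ≤ l * r) (hr2 : r ≤ 2 * L / p) (hrn : r ≤ n)
    (hrx : r * (1 - p) ^ r ≤ 1 / 2)
    (hE : Real.exp L / (4 * L ^ 2) ≤ n.choose r * (1 - (1 - p) ^ r) ^ (n - r))
    (hA : 32 * L ^ 2 / (n * p ^ 2) ≤ 1 / 2) (hB : 9 * L ^ 2 * Real.exp (- L / 2) ≤ 1 / 2) :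
    ∑ s ∈ Finset.range (r + 1), (r.choose s * (n - s).choose (r - s) : ℝ) / n.choose r *
      Real.exp (n * (1 - p) ^ r * ((1 - p) ^ (r - s) - (1 - p) ^ r)) ≤
    1 + (2 * (32 * L ^ 2 / (n * p ^ 2)) + 2 * (9 * L ^ 2 * Real.exp (- L / 2)) +
      16 * L ^ 2 * Real.exp (-L)) := by
  have hcpos : (n.choose r : ℝ) ≠ 0 := by exact_mod_cast (Nat.choose_pos hrn).ne'
  rw [Finset.sum_range_succ']
  -- For disjoint sets the covariance vanishes, so `s = 0` contributes exactly 1.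
  have h0 : (r.choose 0 * (n - 0).choose (r - 0) : ℝ) / n.choose r *
      Real.exp (n * (1 - p) ^ r * ((1 - p) ^ (r - 0) - (1 - p) ^ r)) = 1 := by
    simp [hcpos]
  rw [h0, add_comm]
  gcongr
  have hterm : ∀ i ∈ Finset.range r,
      (r.choose (i + 1) * (n - (i + 1)).choose (r - (i + 1)) : ℝ) / n.choose r *
      Real.exp (n * (1 - p) ^ r * ((1 - p) ^ (r - (i + 1)) - (1 - p) ^ r)) ≤ _ :=
    fun i hi ↦ second_moment_term_le hp0 hp1 hl hl0 hL hL1 hn hnL hLn hM1 hM2 hr1 hr2 hrn hrx hE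
      (Finset.mem_range.1 hi)
  refine (Finset.sum_le_sum hterm).trans ?_
  rw [Finset.sum_add_distrib, Finset.sum_add_distrib]
  refine add_le_add (add_le_add (sum_range_succ_pow_le (by positivity) hA r)
    (sum_range_succ_pow_le (by positivity) hB r)) ?_
  rw [← Finset.sum_mul]
  have hgeo : ∑ i ∈ Finset.range r, (1 / 2 : ℝ) ^ (r - (i + 1)) ≤ 2 := by
    have := Finset.sum_range_reflect (fun i ↦ (1 / 2 : ℝ) ^ i) r
    calc ∑ i ∈ Finset.range r, (1 / 2 : ℝ) ^ (r - (i + 1))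
        = ∑ i ∈ Finset.range r, (1 / 2 : ℝ) ^ (r - 1 - i) := by
          refine Finset.sum_congr rfl fun i _ ↦ ?_
          congr 1
          omega
      _ ≤ 2 := by rw [this]; exact sum_geometric_two_le r
  calc _ ≤ 2 * (8 * L ^ 2 * Real.exp (-L)) := by gcongr
    _ = _ := by ring

/-! ### Chebyshev's inequality, normalised. -/

namespace SimpleGraph

variable {V : Type*} [Fintype V] [DecidableEq V]

/-- Chebyshev's inequality for the number of dominating sets, in normalised form. -/
theorem binomialRandom_real_lt_dominationNumber_le (p : unitInterval) {r : ℕ}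
    (hp1 : (p : ℝ) < 1) (hp0 : 0 < (p : ℝ))
    (hrn : 2 * r ≤ Fintype.card V) (hx : (1 - (p : ℝ)) ^ r ≤ 1 / 2) :
    (binomialRandom V p).real {G | r < G.dominationNumber} ≤
      Real.exp (4 * r * (1 - (p : ℝ)) ^ r + 6 * (Fintype.card V) * ((1 - (p : ℝ)) ^ r) ^ 2) *
        (∑ s ∈ Finset.range (r + 1), (r.choose s * (Fintype.card V - s).choose (r - s) : ℝ) /
          (Fintype.card V).choose r *
          Real.exp (Fintype.card V * (1 - (p : ℝ)) ^ r *
            ((1 - (p : ℝ)) ^ (r - s) - (1 - (p : ℝ)) ^ r))) - 1 := by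
  have key := binomialRandom_real_lt_dominationNumber_mul_le (V := V) p (r := r) (by omega)
  set n := Fintype.card V
  set P := (binomialRandom V p).real {G | r < G.dominationNumber}
  have hterm : ∀ s ∈ Finset.range (r + 1), _ := fun s hs ↦
    joint_pow_le (n := n) hp0.le hp1.le (Nat.lt_succ_iff.1 (Finset.mem_range.1 hs)) hrn hx
  set x := (1 - (p : ℝ)) ^ r
  set c := ((n.choose r : ℕ) : ℝ)
  have hc : 0 < c := Nat.cast_pos.2 (Nat.choose_pos (by omega))
  have hμ : 0 < (c * (1 - x) ^ (n - r)) ^ 2 := by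
    have : 0 < 1 - x := by linarith
    positivity
  have h2 : c * ∑ s ∈ Finset.range (r + 1), (r.choose s * (n - s).choose (r - s) : ℝ) *
      (1 - 2 * x + (1 - (p : ℝ)) ^ (2 * r - s)) ^ (n - (2 * r - s)) ≤
      (c * (1 - x) ^ (n - r)) ^ 2 * (Real.exp (4 * r * x + 6 * n * x ^ 2) *
        ∑ s ∈ Finset.range (r + 1), (r.choose s * (n - s).choose (r - s) : ℝ) / c *
          Real.exp (n * x * ((1 - (p : ℝ)) ^ (r - s) - x))) := by
    rw [Finset.mul_sum, Finset.mul_sum, Finset.mul_sum]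
    refine Finset.sum_le_sum fun s hs ↦ ?_
    calc _ ≤ c * ((r.choose s * (n - s).choose (r - s) : ℝ) * (((1 - x) ^ (n - r)) ^ 2 *
        (Real.exp (4 * r * x + 6 * n * x ^ 2) *
          Real.exp (n * x * ((1 - (p : ℝ)) ^ (r - s) - x))))) := by
          gcongr
          exact hterm s hs
      _ = _ := by field_simp
  rw [le_sub_iff_add_le]
  refine le_of_mul_le_mul_left ?_ hμ
  linarith

end SimpleGraph

/-! ### The expectation, the rate `log q` and the level. -/

/-- The expected number of dominating sets of size `r` in `G(n, p)`. -/
noncomputable def expectedDominating (n r : ℕ) (p : ℝ) : ℝ :=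
  n.choose r * (1 - (1 - p) ^ r) ^ (n - r)

/-- The real number `log_q (n log q / log² (n p))`. -/
noncomputable def dominationLevel (n : ℕ) (p : ℝ) : ℝ :=
  (Real.log n + Real.log (Real.log (qOf p)) - 2 * Real.log (Real.log (n * p))) / Real.log (qOf p)

section rate

variable {p : ℝ}

theorem log_qOf_eq (p : ℝ) : Real.log (qOf p) = -Real.log (1 - p) := by
  rw [qOf, one_div, Real.log_inv]

theorem exp_neg_log_qOf (hp1 : p < 1) : Real.exp (-Real.log (qOf p)) = 1 - p := by
  rw [log_qOf_eq, neg_neg, Real.exp_log (by linarith)]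

theorem le_log_qOf (hp1 : p < 1) : p ≤ Real.log (qOf p) := by
  have := Real.log_le_sub_one_of_pos (by linarith : 0 < 1 - p)
  rw [log_qOf_eq]
  linarith

theorem log_qOf_pos (hp0 : 0 < p) (hp1 : p < 1) : 0 < Real.log (qOf p) :=
  hp0.trans_le (le_log_qOf hp1)

theorem log_qOf_le (hp0 : 0 < p) (hp1 : p < 1) :
    Real.log (qOf p) ≤ p * (1 + Real.log (qOf p)) := by
  have h1 := exp_neg_log_qOf hp1
  have hl := log_qOf_pos hp0 hp1
  set l := Real.log (qOf p)
  have h2 := Real.add_one_le_exp l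
  have h3 : (1 - p) * Real.exp l = 1 := by rw [← h1, ← Real.exp_add]; simp
  nlinarith

end rate

section level

variable {n : ℕ} {p : ℝ}

theorem mul_dominationLevel (hp0 : 0 < p) (hp1 : p < 1) :
    Real.log (qOf p) * dominationLevel n p =
      Real.log n + Real.log (Real.log (qOf p)) - 2 * Real.log (Real.log (n * p)) := by
  rw [dominationLevel, mul_div_cancel₀ _ (log_qOf_pos hp0 hp1).ne']

theorem le_mul_dominationLevel (hn : n ≠ 0) (hp0 : 0 < p) (hp1 : p < 1) :
    Real.log (n * p) - 2 * Real.log (Real.log (n * p)) ≤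
      Real.log (qOf p) * dominationLevel n p := by
  rw [mul_dominationLevel hp0 hp1]
  have hn0 : (0 : ℝ) < n := by positivity
  have h1 := Real.log_le_log hp0 (le_log_qOf hp1)
  have h2 := Real.log_mul hn0.ne' hp0.ne'
  linarith

/-- `n q ^ (-r)` in terms of the distance of `r` to the level. -/
theorem mul_one_sub_pow_eq (hn : n ≠ 0) (hp0 : 0 < p) (hp1 : p < 1)
    (hL : 0 < Real.log (n * p)) (r : ℕ) :
    n * (1 - p) ^ r = Real.log (n * p) ^ 2 / Real.log (qOf p) *
      Real.exp (Real.log (qOf p) * dominationLevel n p - Real.log (qOf p) * r) := by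
  have hn0 : (0 : ℝ) < n := by positivity
  have hl := log_qOf_pos hp0 hp1
  rw [mul_dominationLevel hp0 hp1, Real.exp_sub, Real.exp_sub, Real.exp_add, Real.exp_log hn0,
    Real.exp_log hl, two_mul, Real.exp_add, Real.exp_log hL, ← exp_neg_log_qOf hp1,
    ← Real.exp_nat_mul, mul_neg, Real.exp_neg, mul_comm (r : ℝ)]
  field_simp

/-- Supplies the bound `r ≤ 2L/p` for all relevant sizes. By `log_qOf_le`, a rate at most 1 is at
most `2p`, while a rate at least 1 forces `p ≥ 1/2`. -/
theorem dominationLevel_add_le (hn : n ≠ 0) (hp0 : 0 < p) (hp1 : p < 1)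
    (hL : 10 ≤ Real.log (n * p)) :
    dominationLevel n p + 2 + 1 / Real.log (qOf p) ≤ 2 * Real.log (n * p) / p := by
  have hn0 : (0 : ℝ) < n := by positivity
  have hl := log_qOf_pos hp0 hp1
  have hpl := le_log_qOf hp1
  have hlp := log_qOf_le hp0 hp1
  have hnp := Real.log_mul hn0.ne' hp0.ne'
  have hlogL : 0 ≤ Real.log (Real.log (n * p)) := Real.log_nonneg (by linarith)
  have hr := mul_dominationLevel (n := n) hp0 hp1
  set l := Real.log (qOf p)
  set L := Real.log (n * p)
  set ρ := dominationLevel n p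
  have hlog2 := Real.log_two_lt_d9
  rcases le_total l 1 with h1 | h1
  · have h2 : Real.log l ≤ Real.log 2 + Real.log p := by
      rw [← Real.log_mul two_ne_zero hp0.ne']
      exact Real.log_le_log hl (by nlinarith)
    have h3 : l * (ρ + 2 + 1 / l) ≤ 2 * L := by
      have : l * (ρ + 2 + 1 / l) = l * ρ + 2 * l + 1 := by field_simp
      rw [this]
      linarith
    calc ρ + 2 + 1 / l = l * (ρ + 2 + 1 / l) / l := by field_simp
      _ ≤ 2 * L / l := by gcongr
      _ ≤ 2 * L / p := by gcongr
  · have hp2 : 1 / 2 ≤ p := by nlinarith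
    have h2 : -Real.log 2 ≤ Real.log p := by
      rw [← Real.log_inv]
      exact Real.log_le_log (by norm_num) (by norm_num at hp2 ⊢; exact hp2)
    have h4 := Real.log_le_sub_one_of_pos hl
    have h5 : ρ ≤ L + 2 := by
      refine le_of_mul_le_mul_left ?_ hl
      rw [hr]
      nlinarith
    have h6 : 1 / l ≤ 1 := by rw [div_le_one hl]; exact h1
    calc ρ + 2 + 1 / l ≤ 2 * L := by linarith
      _ ≤ 2 * L / p := by rw [le_div_iff₀ hp0]; nlinarith

end level

/-! ### The expectation below and above the level. -/

/-- One term of the binomial expansion of `(1 + z)^n` is at most the whole, which is at most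
`e^{nz}`; `z` is left free for optimisation. -/
theorem choose_mul_pow_le_exp {n r : ℕ} {z : ℝ} (hz : 0 < z) :
    (n.choose r : ℝ) ≤ Real.exp (n * z - r * Real.log z) := by
  rcases lt_or_ge n r with h | hrn
  · rw [Nat.choose_eq_zero_of_lt h]
    simpa using (Real.exp_pos _).le
  have h1 : z ^ r * n.choose r ≤ (z + 1) ^ n := by
    rw [add_pow]
    have := Finset.single_le_sum (f := fun m ↦ z ^ m * 1 ^ (n - m) * (n.choose m : ℝ))
      (s := Finset.range (n + 1)) (fun i _ ↦ by positivity)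
      (Finset.mem_range.2 (Nat.lt_succ_of_le hrn))
    simpa using this
  have h2 : (z + 1) ^ n ≤ Real.exp (n * z) := by
    rw [Real.exp_nat_mul]
    exact pow_le_pow_left₀ (by positivity) (Real.add_one_le_exp z) n
  have h3 : Real.exp (r * Real.log z) = z ^ r := by rw [Real.exp_nat_mul, Real.exp_log hz]
  rw [Real.exp_sub, h3, le_div_iff₀ (by positivity)]
  linarith

set_option maxHeartbeats 1600000 in
/-- Below the level there are few dominating sets. -/
theorem expectedDominating_lt {n r : ℕ} {p δ : ℝ} (hn : n ≠ 0) (hp0 : 0 < p) (hp1 : p < 1)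
    (hδ0 : 0 < δ) (hδ1 : δ ≤ 1) (hL : 64 / δ ≤ Real.log (n * p))
    (hlogL : Real.log (Real.log (n * p)) ≤ δ * Real.log (n * p) / 64)
    (hexp : Real.log (n * p) ^ 2 * Real.exp (-Real.log (n * p)) ≤ δ / 8)
    (hnL : Real.log n ≤ 2 * Real.log (n * p))
    (hr : r ≤ dominationLevel n p - δ / Real.log (qOf p)) :
    expectedDominating n r p < 1 / Real.log (n * p) := by
  have hn0 : (0 : ℝ) < n := by positivity
  have hl := log_qOf_pos hp0 hp1
  have hlp := log_qOf_le hp0 hp1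
  have hL64 : 64 ≤ Real.log (n * p) := le_trans (by rw [le_div_iff₀ hδ0]; linarith) hL
  have hL0 : 0 < Real.log (n * p) := by linarith
  have hllog0 : 0 ≤ Real.log (Real.log (n * p)) := Real.log_nonneg (by linarith)
  rcases Nat.eq_zero_or_pos r with rfl | hrpos
  · simp [expectedDominating, hn, hL0]
  have hlev := mul_dominationLevel (n := n) hp0 hp1
  have hr3 := dominationLevel_add_le hn hp0 hp1 (by linarith : 10 ≤ Real.log (n * p))
  have hM := mul_one_sub_pow_eq hn hp0 hp1 hL0 r
  have hnp : (n : ℝ) * p = Real.exp (Real.log (n * p)) := (Real.exp_log (by positivity)).symm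
  have hx0 : 0 < (1 - p) ^ r := pow_pos (by linarith) _
  have hx1 : (1 - p) ^ r ≤ 1 := pow_le_one₀ (by linarith) (by linarith)
  rw [expectedDominating]
  set x := (1 - p) ^ r
  set l := Real.log (qOf p)
  set L := Real.log (n * p) with hLdef
  set ρ := dominationLevel n p
  have hr1 : (1 : ℝ) ≤ r := by exact_mod_cast hrpos
  have hδl : 0 < δ / l := by positivity
  have hlr : l * r ≤ l * ρ - δ := by
    calc l * r ≤ l * (ρ - δ / l) := by gcongr
      _ = l * ρ - δ := by field_simp
  have hl4 : l ≤ 4 * L := by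
    have h1 : Real.log l ≤ l / 2 := by
      have h2 := Real.log_le_sub_one_of_pos (by positivity : 0 < l / 2)
      rw [Real.log_div hl.ne' two_ne_zero] at h2
      have := Real.log_two_lt_d9
      linarith
    nlinarith
  have hy : Real.log n + Real.log l ≤ L + Real.log L + 3 := by
    have h1 : l ≤ p * Real.exp (3 + Real.log L) := by
      have h8 : 8 ≤ Real.exp 3 := by
        have h9 : Real.exp 3 = Real.exp 1 ^ 3 := by rw [← Real.exp_nat_mul]; norm_num
        have := Real.exp_one_gt_d9
        rw [h9]
        calc (8 : ℝ) = 2 ^ 3 := by norm_num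
          _ ≤ _ := by gcongr; linarith
      rw [Real.exp_add, Real.exp_log hL0]
      calc l ≤ p * (1 + l) := hlp
        _ ≤ p * (8 * L) := by gcongr; linarith
        _ ≤ _ := by gcongr
    have h2 := Real.log_le_log hl h1
    rw [Real.log_mul hp0.ne' (Real.exp_pos _).ne', Real.log_exp] at h2
    have h3 := Real.log_mul hn0.ne' hp0.ne'
    linarith
  -- The optimal `z` is `r/n`, and `r` is about `L/l` near the level.
  have hz : 0 < L / (n * l) := by positivity
  have hc := choose_mul_pow_le_exp (n := n) (r := r) hz
  have hlogz : Real.log (L / (n * l)) = Real.log L - (Real.log n + Real.log l) := by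
    rw [Real.log_div hL0.ne' (by positivity), Real.log_mul hn0.ne' hl.ne']
  rcases lt_or_ge n r with hnr | hrn
  · rw [Nat.choose_eq_zero_of_lt hnr]
    simp [hL0]
  have hc2 : (n.choose r : ℝ) ≤ Real.exp ((L + (L + 3) ^ 2) / l) := by
    refine hc.trans (Real.exp_le_exp.2 ?_)
    rw [le_div_iff₀ hl, hlogz]
    have h1 : (n * (L / (n * l))) * l = L := by field_simp
    have h2 : (l * r) * (Real.log n + Real.log l - Real.log L) ≤ (L + 3) * (L + 3) := by
      calc (l * r) * (Real.log n + Real.log l - Real.log L) ≤ (l * r) * (L + 3) := by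
            gcongr; linarith
        _ ≤ _ := by gcongr; linarith
    nlinarith
  have hx2 : (1 - x) ^ (n - r) ≤ Real.exp (-((1 + δ / 2) * L ^ 2 / l)) := by
    have h1 : 1 - x ≤ Real.exp (-x) := by have := Real.add_one_le_exp (-x); linarith
    calc (1 - x) ^ (n - r) ≤ Real.exp (-x) ^ (n - r) := pow_le_pow_left₀ (by linarith) h1 _
      _ = Real.exp ((n - r : ℕ) * (-x)) := by rw [Real.exp_nat_mul]
      _ ≤ _ := by
        refine Real.exp_le_exp.2 ?_
        rw [Nat.cast_sub hrn]
        have h2 : (1 + δ) * (L ^ 2 / l) ≤ n * x := by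
          rw [hM, mul_comm (L ^ 2 / l)]
          gcongr
          have := Real.add_one_le_exp (l * ρ - l * r)
          linarith
        have h3 : (r : ℝ) ≤ n * (δ / 4) := by
          have h4 : (r : ℝ) ≤ 2 * L / p := by
            have : 0 < 1 / l := by positivity
            linarith
          refine h4.trans ?_
          rw [div_le_iff₀ hp0]
          have h5 : L ^ 2 * Real.exp (-L) * Real.exp L ≤ δ / 8 * Real.exp L := by gcongr
          rw [mul_assoc, ← Real.exp_add, neg_add_cancel, Real.exp_zero, mul_one, ← hnp] at h5
          nlinarith
        have h6 : (1 + δ / 2) * (L ^ 2 / l) ≤ (n - r) * x := by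
          have hT : 0 < L ^ 2 / l := by positivity
          calc (1 + δ / 2) * (L ^ 2 / l) ≤ ((1 - δ / 4) * (1 + δ)) * (L ^ 2 / l) := by
                gcongr
                nlinarith
            _ ≤ (1 - δ / 4) * (n * x) := by
              rw [mul_assoc]
              gcongr
              linarith
            _ ≤ (n - r) * x := by
              have := mul_le_mul_of_nonneg_right h3 hx0.le
              linarith
        rw [mul_div_assoc]
        linarith
  -- The number of sets contributes at most `(1 + δ/4) L²/l`, so a surplus `δ L²/(4l)` remains, and
  -- `l ≤ 4L` makes it at least `δ L/16`.
  have hfin : (L + (L + 3) ^ 2) / l + -((1 + δ / 2) * L ^ 2 / l) ≤ -(δ * L / 16) := by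
    have h1 : L + (L + 3) ^ 2 ≤ (1 + δ / 4) * L ^ 2 := by
      have h2 : 64 ≤ L * δ := by rwa [div_le_iff₀ hδ0] at hL
      have := mul_le_mul_of_nonneg_right h2 hL0.le
      nlinarith only [this, hL64]
    have h3 : δ * L / 16 * l ≤ δ / 4 * L ^ 2 := by
      calc δ * L / 16 * l ≤ δ * L / 16 * (4 * L) := by gcongr
        _ = _ := by ring
    have h4 : ((L + (L + 3) ^ 2) / l + -((1 + δ / 2) * L ^ 2 / l)) =
        (L + (L + 3) ^ 2 - (1 + δ / 2) * L ^ 2) / l := by ring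
    rw [h4, div_le_iff₀ hl]
    linarith
  calc (n.choose r : ℝ) * (1 - x) ^ (n - r)
      ≤ Real.exp ((L + (L + 3) ^ 2) / l) * Real.exp (-((1 + δ / 2) * L ^ 2 / l)) :=
        mul_le_mul hc2 hx2 (pow_nonneg (by linarith) _) (Real.exp_pos _).le
    _ ≤ Real.exp (-(δ * L / 16)) := by rw [← Real.exp_add]; exact Real.exp_le_exp.2 hfin
    _ < Real.exp (-Real.log L) := by
      refine Real.exp_lt_exp.2 ?_
      have : 0 < δ * L := by positivity
      linarith
    _ = 1 / L := by rw [Real.exp_neg, Real.exp_log hL0, one_div]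

set_option maxHeartbeats 1600000 in
/-- Above the level there are many dominating sets. -/
theorem one_le_expectedDominating {n r : ℕ} {p δ : ℝ} (hn : n ≠ 0) (hp0 : 0 < p) (hp1 : p < 1)
    (hδ0 : 0 < δ) (hδ1 : δ ≤ 1) (hL : 64 / δ ≤ Real.log (n * p))
    (hlogL : Real.log (Real.log (n * p)) ≤ δ * Real.log (n * p) / 64)
    (hexp : Real.log (n * p) ^ 2 * Real.exp (-Real.log (n * p)) ≤ δ / 8)
    (hr : dominationLevel n p + δ / Real.log (qOf p) ≤ r)
    (hr2 : r ≤ 2 * Real.log (n * p) / p) (hrn : r ≤ n) :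
    1 ≤ expectedDominating n r p := by
  have hn0 : (0 : ℝ) < n := by positivity
  have hl := log_qOf_pos hp0 hp1
  have hpl := le_log_qOf hp1
  have hL64 : 64 ≤ Real.log (n * p) := le_trans (by rw [le_div_iff₀ hδ0]; linarith) hL
  have hL0 : 0 < Real.log (n * p) := by linarith
  have hllog0 : 0 ≤ Real.log (Real.log (n * p)) := Real.log_nonneg (by linarith)
  have hlev := le_mul_dominationLevel hn hp0 hp1
  have hM := mul_one_sub_pow_eq hn hp0 hp1 hL0 r
  have hnp : (n : ℝ) * p = Real.exp (Real.log (n * p)) := (Real.exp_log (by positivity)).symm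
  have hx0 : 0 < (1 - p) ^ r := pow_pos (by linarith) _
  rw [expectedDominating]
  set x := (1 - p) ^ r
  set l := Real.log (qOf p)
  set L := Real.log (n * p) with hLdef
  set ρ := dominationLevel n p
  have hlr : l * ρ + δ ≤ l * r := by
    calc l * ρ + δ = l * (ρ + δ / l) := by field_simp
      _ ≤ l * r := by gcongr
  have hlr2 : L - 2 * Real.log L ≤ l * r := by linarith
  have hr0 : (0 : ℝ) < r := by
    have : 0 < l * r := by nlinarith
    exact (mul_pos_iff_of_pos_left hl).1 this
  have hM2 : n * x ≤ (1 - δ / 2) * (L ^ 2 / l) := by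
    rw [hM, mul_comm (L ^ 2 / l)]
    gcongr
    calc Real.exp (l * ρ - l * r) ≤ Real.exp (-δ) := Real.exp_le_exp.2 (by linarith)
      _ ≤ 1 / (1 + δ) := by
        rw [Real.exp_neg, ← one_div]
        refine one_div_le_one_div_of_le (by linarith) ?_
        have := Real.add_one_le_exp δ
        linarith
      _ ≤ 1 - δ / 2 := by rw [div_le_iff₀ (by linarith)]; nlinarith
  have hx1 : x ≤ δ / 8 := by
    have h1 : n * x ≤ L ^ 2 / p := by
      refine hM2.trans ?_
      calc (1 - δ / 2) * (L ^ 2 / l) ≤ 1 * (L ^ 2 / p) := by gcongr; linarith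
        _ = _ := one_mul _
    rw [le_div_iff₀ hp0] at h1
    have h2 : x * Real.exp L ≤ L ^ 2 := by rw [← hnp]; linarith
    calc x = x * Real.exp L * Real.exp (-L) := by
          rw [mul_assoc, ← Real.exp_add, add_neg_cancel, Real.exp_zero, mul_one]
      _ ≤ L ^ 2 * Real.exp (-L) := by gcongr
      _ ≤ δ / 8 := hexp
  have hc : Real.exp (r * (L - (1 + Real.log L))) ≤ n.choose r := by
    have h1 := choose_mul_pow_le_choose_mul_pow hrn r
    rw [Nat.choose_self, Nat.cast_one, one_mul] at h1
    have h2 : Real.exp (L - (1 + Real.log L)) ≤ n / r := by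
      rw [Real.exp_sub, Real.exp_add, Real.exp_log hL0, ← hnp, le_div_iff₀ hr0,
        div_mul_eq_mul_div, div_le_iff₀ (by positivity)]
      rw [le_div_iff₀ hp0] at hr2
      have h3 : 2 ≤ Real.exp 1 := by have := Real.exp_one_gt_d9; linarith
      have h4 : 2 * L ≤ Real.exp 1 * L := by gcongr
      calc (n : ℝ) * p * r = n * (r * p) := by ring
        _ ≤ n * (Real.exp 1 * L) := mul_le_mul_of_nonneg_left (by linarith) hn0.le
    calc Real.exp (r * (L - (1 + Real.log L))) = Real.exp (L - (1 + Real.log L)) ^ r := by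
          rw [Real.exp_nat_mul]
      _ ≤ (n / r) ^ r := by gcongr
      _ ≤ n.choose r := by rw [div_pow, div_le_iff₀ (by positivity)]; exact h1
  have hx2 : Real.exp (-((1 - δ / 4) * (L ^ 2 / l))) ≤ (1 - x) ^ (n - r) := by
    have h1x : 0 < 1 - x := by linarith
    -- The bound `x ≤ δ/8` pays for the second-order term of `log (1 - x)`.
    have h1 : Real.exp (-(x * (1 + δ / 4))) ≤ 1 - x := by
      have h2 := Real.add_one_le_exp (x * (1 + δ / 4))
      rw [Real.exp_neg, inv_le_comm₀ (Real.exp_pos _) h1x, ← one_div, div_le_iff₀ h1x]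
      calc 1 ≤ (x * (1 + δ / 4) + 1) * (1 - x) := by
            have : 0 ≤ δ / 4 - x * (1 + δ / 4) := by nlinarith
            nlinarith [mul_nonneg hx0.le this]
        _ ≤ _ := by gcongr
    calc Real.exp (-((1 - δ / 4) * (L ^ 2 / l))) ≤ Real.exp (n * (-(x * (1 + δ / 4)))) := by
          refine Real.exp_le_exp.2 ?_
          have hT : 0 < L ^ 2 / l := by positivity
          have : n * x * (1 + δ / 4) ≤ (1 - δ / 4) * (L ^ 2 / l) := by
            calc n * x * (1 + δ / 4) ≤ (1 - δ / 2) * (L ^ 2 / l) * (1 + δ / 4) := by gcongr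
              _ = ((1 - δ / 2) * (1 + δ / 4)) * (L ^ 2 / l) := by ring
              _ ≤ _ := by gcongr; nlinarith
          linarith
      _ = Real.exp (-(x * (1 + δ / 4))) ^ n := by rw [Real.exp_nat_mul]
      _ ≤ (1 - x) ^ n := by gcongr
      _ ≤ (1 - x) ^ (n - r) := pow_le_pow_of_le_one h1x.le (by linarith) (Nat.sub_le _ _)
  have hfin : (1 - δ / 4) * (L ^ 2 / l) ≤ r * (L - (1 + Real.log L)) := by
    have h1 : (1 - δ / 4) * L ^ 2 ≤ (L - 2 * Real.log L) * (L - (1 + Real.log L)) := by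
      have h2 : 64 ≤ L * δ := by rwa [div_le_iff₀ hδ0] at hL
      have h3 := mul_le_mul_of_nonneg_right h2 hL0.le
      have h4 := mul_le_mul_of_nonneg_right hlogL hL0.le
      nlinarith only [h3, h4, hllog0, hL64, mul_nonneg hllog0 hllog0]
    have h3 : (L - 2 * Real.log L) * (L - (1 + Real.log L)) ≤
        (l * r) * (L - (1 + Real.log L)) := by
      gcongr
      nlinarith
    calc (1 - δ / 4) * (L ^ 2 / l) = (1 - δ / 4) * L ^ 2 / l := by ring
      _ ≤ (l * r) * (L - (1 + Real.log L)) / l :=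
        div_le_div_of_nonneg_right (h1.trans h3) hl.le
      _ = _ := by field_simp
  calc (1 : ℝ) ≤ Real.exp (r * (L - (1 + Real.log L)) + -((1 - δ / 4) * (L ^ 2 / l))) :=
        Real.one_le_exp (by linarith)
    _ = Real.exp (r * (L - (1 + Real.log L))) * Real.exp (-((1 - δ / 4) * (L ^ 2 / l))) :=
        Real.exp_add _ _
    _ ≤ _ := by gcongr

/-- The factor is the ratio of consecutive binomial coefficients; the domination probability only
grows with the size of the set. -/
theorem expectedDominating_succ_ge {n k : ℕ} {p : ℝ} (hp0 : 0 ≤ p) (hp1 : p ≤ 1) (hk : k ≤ n) :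
    expectedDominating n k p * ((n - k) / (k + 1)) ≤ expectedDominating n (k + 1) p := by
  have h1 : (n.choose (k + 1) : ℝ) * (k + 1) = n.choose k * (n - k) := by
    have := Nat.choose_succ_right_eq n k
    rw [← Nat.cast_sub hk]
    exact_mod_cast this
  have h2 : (1 - (1 - p) ^ k) ^ (n - k) ≤ (1 - (1 - p) ^ (k + 1)) ^ (n - (k + 1)) := by
    have hq0 : 0 ≤ 1 - p := by linarith
    have hq1 : 1 - p ≤ 1 := by linarith
    have h3 : (1 - p) ^ (k + 1) ≤ (1 - p) ^ k := pow_le_pow_of_le_one hq0 hq1 (Nat.le_succ k)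
    have h4 : (1 - p) ^ k ≤ 1 := pow_le_one₀ hq0 hq1
    have h5 : 0 ≤ (1 - p) ^ k := pow_nonneg hq0 _
    calc (1 - (1 - p) ^ k) ^ (n - k) ≤ (1 - (1 - p) ^ k) ^ (n - (k + 1)) :=
          pow_le_pow_of_le_one (by linarith) (by linarith) (by omega)
      _ ≤ _ := pow_le_pow_left₀ (by linarith) (by linarith) _
  have h6 : (n.choose (k + 1) : ℝ) = n.choose k * ((n - k) / (k + 1)) := by
    field_simp
    exact h1
  rw [expectedDominating, expectedDominating, h6, mul_right_comm]
  have h7 : (0 : ℝ) ≤ n - k := by rw [sub_nonneg]; exact_mod_cast hk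
  gcongr

/-! ### The threshold and the real point attached to it. -/

/-- The least size for which the expected number of dominating sets of that size is at least
`1 / log (n p)`. -/
noncomputable def dominationThreshold (n : ℕ) (p : ℝ) : ℕ :=
  sInf {r : ℕ | 1 / Real.log (n * p) ≤ expectedDominating n r p}

/-- The domination level, moved into the interval `[k - 1, k)` for the threshold `k`. -/
noncomputable def dominationPoint (n : ℕ) (p : ℝ) : ℝ :=
  max ((dominationThreshold n p : ℝ) - 1)
    (min (dominationLevel n p)
      -- The gap keeps the point strictly below `k`, and is so small that `log q` times it is at
      -- most `1/(n+1)`.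
      (dominationThreshold n p - 1 / ((n + 1) * (1 + Real.log (qOf p)))))

theorem floor_dominationPoint (n : ℕ) {p : ℝ} (hp0 : 0 < p) (hp1 : p < 1) :
    ⌊dominationPoint n p⌋ = (dominationThreshold n p : ℤ) - 1 := by
  have hl := log_qOf_pos hp0 hp1
  rw [Int.floor_eq_iff]
  push_cast
  refine ⟨le_max_left _ _, ?_⟩
  have h1 : 0 < 1 / (((n : ℝ) + 1) * (1 + Real.log (qOf p))) := by positivity
  refine max_lt (by linarith) ((min_le_right _ _).trans_lt (by linarith))

theorem abs_dominationPoint_sub_le {n : ℕ} {p δ : ℝ} (hp0 : 0 < p) (hp1 : p < 1) (hδ : 0 ≤ δ)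
    (h1 : dominationLevel n p - δ / Real.log (qOf p) ≤ dominationThreshold n p)
    (h2 : dominationThreshold n p ≤ dominationLevel n p + δ / Real.log (qOf p) + 1) :
    |Real.log (qOf p) * (dominationPoint n p - dominationLevel n p)| ≤ δ + 1 / (n + 1) := by
  have hl := log_qOf_pos hp0 hp1
  have hk : 0 < 1 / (((n : ℝ) + 1) * (1 + Real.log (qOf p))) := by positivity
  have hk2 : Real.log (qOf p) * (1 / (((n : ℝ) + 1) * (1 + Real.log (qOf p)))) ≤ 1 / (n + 1) := by
    rw [mul_one_div, div_le_div_iff₀ (by positivity) (by positivity)]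
    nlinarith [(by positivity : (0 : ℝ) < n + 1)]
  unfold dominationPoint
  set l := Real.log (qOf p)
  set ρ := dominationLevel n p
  set k := ((dominationThreshold n p : ℕ) : ℝ)
  set η := 1 / (((n : ℝ) + 1) * (1 + l))
  have hd0 : 0 ≤ δ / l := by positivity
  have hupper : max (k - 1) (min ρ (k - η)) ≤ ρ + δ / l :=
    max_le (by linarith) ((min_le_left _ _).trans (by linarith))
  have hlower : ρ - δ / l - η ≤ max (k - 1) (min ρ (k - η)) :=
    le_trans (le_min (by linarith) (by linarith)) (le_max_right _ _)
  have hn1 : 0 ≤ 1 / ((n : ℝ) + 1) := by positivity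
  have h3 : l * (δ / l) = δ := by field_simp
  rw [abs_le]
  constructor
  · have : l * (-(δ / l) - η) ≤ l * (max (k - 1) (min ρ (k - η)) - ρ) := by
      refine mul_le_mul_of_nonneg_left ?_ hl.le
      linarith
    nlinarith
  · have : l * (max (k - 1) (min ρ (k - η)) - ρ) ≤ l * (δ / l) := by
      refine mul_le_mul_of_nonneg_left ?_ hl.le
      linarith
    linarith

/-- Minimality of the threshold and the one-sided estimates around the level suffice; monotonicity
of the expectation in `r` is not needed. The `+ 1` in the upper bound comes from rounding up to an
integer. -/
theorem dominationThreshold_spec {n : ℕ} {p δ : ℝ} (hn : n ≠ 0) (hp0 : 0 < p) (hp1 : p < 1)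
    (hδ0 : 0 < δ) (hδ1 : δ ≤ 1) (hL : 64 / δ ≤ Real.log (n * p))
    (hlogL : Real.log (Real.log (n * p)) ≤ δ * Real.log (n * p) / 64)
    (hexp : Real.log (n * p) ^ 2 * Real.exp (-Real.log (n * p)) ≤ δ / 8)
    (hnL : Real.log n ≤ 2 * Real.log (n * p)) :
    1 ≤ dominationThreshold n p ∧
    1 / Real.log (n * p) ≤ expectedDominating n (dominationThreshold n p) p ∧
    expectedDominating n (dominationThreshold n p - 1) p < 1 / Real.log (n * p) ∧
    dominationLevel n p - δ / Real.log (qOf p) ≤ dominationThreshold n p ∧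
    dominationThreshold n p ≤ dominationLevel n p + δ / Real.log (qOf p) + 1 ∧
    (dominationThreshold n p : ℝ) + 1 ≤ 2 * Real.log (n * p) / p ∧
    2 * (dominationThreshold n p + 1) ≤ n := by
  have hn0 : (0 : ℝ) < n := by positivity
  have hl := log_qOf_pos hp0 hp1
  have hL64 : 64 ≤ Real.log (n * p) := le_trans (by rw [le_div_iff₀ hδ0]; linarith) hL
  have hL0 : 0 < Real.log (n * p) := by linarith
  have hne : {r : ℕ | 1 / Real.log (n * p) ≤ expectedDominating n r p}.Nonempty := by
    refine ⟨n, ?_⟩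
    simp only [Set.mem_ofPred_eq, expectedDominating, Nat.choose_self, Nat.sub_self, pow_zero,
      Nat.cast_one, mul_one]
    rw [div_le_one hL0]
    linarith
  have hmem : 1 / Real.log (n * p) ≤ expectedDominating n (dominationThreshold n p) p :=
    Nat.sInf_mem hne
  have hk1 : 1 ≤ dominationThreshold n p := by
    rw [Nat.one_le_iff_ne_zero]
    intro h0
    rw [h0] at hmem
    have h2 : expectedDominating n 0 p = 0 := by simp [expectedDominating, hn]
    rw [h2] at hmem
    have : 0 < 1 / Real.log (n * p) := by positivity
    linarith
  have hlt : expectedDominating n (dominationThreshold n p - 1) p < 1 / Real.log (n * p) := by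
    have : dominationThreshold n p - 1 < dominationThreshold n p := by omega
    exact not_le.1 (Nat.notMem_of_lt_sInf this)
  have hρ0 : 0 ≤ dominationLevel n p := by
    have h1 := le_mul_dominationLevel hn hp0 hp1
    have h2 : 0 ≤ Real.log (qOf p) * dominationLevel n p := by nlinarith
    exact nonneg_of_mul_nonneg_right h2 hl
  have h3 := dominationLevel_add_le hn hp0 hp1 (by linarith)
  have hδl : δ / Real.log (qOf p) ≤ 1 / Real.log (qOf p) := by gcongr
  have hδ0l : 0 < δ / Real.log (qOf p) := by positivity
  have hlow : dominationLevel n p - δ / Real.log (qOf p) ≤ dominationThreshold n p := by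
    by_contra hcon
    exact absurd (expectedDominating_lt hn hp0 hp1 hδ0 hδ1 hL hlogL hexp hnL (not_le.1 hcon).le)
      (not_lt.2 hmem)
  have hnp : (n : ℝ) * p = Real.exp (Real.log (n * p)) := (Real.exp_log (by positivity)).symm
  have h4L : 2 * (2 * Real.log (n * p) / p) ≤ n := by
    rw [← mul_div_assoc, div_le_iff₀ hp0]
    set L := Real.log (n * p)
    rw [hnp]
    have h5 : L ^ 2 * Real.exp (-L) * Real.exp L ≤ 1 * Real.exp L := by gcongr; linarith
    rw [mul_assoc, ← Real.exp_add, neg_add_cancel, Real.exp_zero, mul_one, one_mul] at h5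
    nlinarith
  have hup : (dominationThreshold n p : ℝ) ≤ dominationLevel n p + δ / Real.log (qOf p) + 1 := by
    have hceil := Nat.ceil_lt_add_one (by positivity :
      0 ≤ dominationLevel n p + δ / Real.log (qOf p))
    set r := ⌈dominationLevel n p + δ / Real.log (qOf p)⌉₊
    have hr2 : (r : ℝ) ≤ 2 * Real.log (n * p) / p := by linarith
    have hrn : r ≤ n := by
      have : (r : ℝ) ≤ n := by
        have : 0 ≤ 2 * Real.log (n * p) / p := by positivity
        linarith
      exact_mod_cast this
    have h6 := one_le_expectedDominating hn hp0 hp1 hδ0 hδ1 hL hlogL hexp (Nat.le_ceil _) hr2 hrn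
    have h7 : dominationThreshold n p ≤ r := by
      refine Nat.sInf_le ?_
      refine le_trans ?_ h6
      rw [div_le_one hL0]
      linarith
    have h8 : (dominationThreshold n p : ℝ) ≤ r := by exact_mod_cast h7
    linarith
  have hk2 : (dominationThreshold n p : ℝ) + 1 ≤ 2 * Real.log (n * p) / p := by linarith
  refine ⟨hk1, hmem, hlt, hlow, hup, hk2, ?_⟩
  have : (2 * (dominationThreshold n p + 1) : ℝ) ≤ n := by linarith
  exact_mod_cast this

/-! ### Two-point concentration with explicit error. -/

set_option maxHeartbeats 800000 in
/-- Quantitative two-point concentration of the domination number. -/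
theorem binomialRandom_real_compl_twoPointEvent_le {n : ℕ} {p : unitInterval} (hn : n ≠ 0)
    (hp0 : 0 < (p : ℝ)) (hp1 : (p : ℝ) < 1) (hL : 128 ≤ Real.log (n * p))
    (hlogL2 : 90 * (1 + 2 * Real.log (Real.log (n * p))) ≤ Real.log (n * p))
    (hexp : Real.log (n * p) ^ 2 * Real.exp (-Real.log (n * p)) ≤ 1 / 16)
    (hnL : Real.log n ≤ 2 * Real.log (n * p))
    (hη : Real.log (n * p) ^ 4 / (n * p ^ 2) ≤ 1 / 64)
    (hB : 9 * Real.log (n * p) ^ 2 * Real.exp (-Real.log (n * p) / 2) ≤ 1 / 2) :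
    (SimpleGraph.binomialRandom (Fin n) p).real (twoPointEvent n (dominationPoint n p))ᶜ ≤
      1 / Real.log (n * p) + 272 * (Real.log (n * p) ^ 4 / (n * p ^ 2)) +
        54 * (Real.log (n * p) ^ 2 * Real.exp (-Real.log (n * p) / 2)) +
        48 * (Real.log (n * p) ^ 2 * Real.exp (-Real.log (n * p))) := by
  obtain ⟨hk1, hmem, hlt, hlow, hup, hk2, hkn⟩ := dominationThreshold_spec (δ := 1 / 2) hn hp0 hp1
    (by norm_num) (by norm_num) (by linarith) (by linarith) (by linarith) hnL
  have hfloor := floor_dominationPoint n hp0 hp1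
  set k := dominationThreshold n p with hk
  have hsub : (twoPointEvent n (dominationPoint n p))ᶜ ⊆
      {G : SimpleGraph (Fin n) | G.dominationNumber ≤ k - 1} ∪
        {G : SimpleGraph (Fin n) | k + 1 < G.dominationNumber} := by
    intro G hG
    simp only [twoPointEvent, Set.mem_compl_iff, Set.mem_ofPred_eq, Set.mem_union, hfloor] at hG ⊢
    omega
  have hfirst : (SimpleGraph.binomialRandom (Fin n) p).real
      {G : SimpleGraph (Fin n) | G.dominationNumber ≤ k - 1} ≤ 1 / Real.log (n * p) := by
    refine (SimpleGraph.binomialRandom_real_dominationNumber_le p (by simp; omega)).trans ?_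
    rw [Fintype.card_fin]
    exact hlt.le
  have hn0 : (0 : ℝ) < n := by positivity
  have hl := log_qOf_pos hp0 hp1
  have hpl := le_log_qOf hp1
  have hL0 : 0 < Real.log (n * p) := by linarith
  have hM := mul_one_sub_pow_eq hn hp0 hp1 hL0 (k + 1)
  have hlev := le_mul_dominationLevel hn hp0 hp1
  have hel := exp_neg_log_qOf hp1
  have hnp : (n : ℝ) * p = Real.exp (Real.log (n * p)) := (Real.exp_log (by positivity)).symm
  have hx0 : 0 < (1 - (p : ℝ)) ^ (k + 1) := pow_pos (by linarith) _
  have hsucc := expectedDominating_succ_ge (k := k) hp0.le hp1.le (by omega : k ≤ n)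
  have hcheb := SimpleGraph.binomialRandom_real_lt_dominationNumber_le (V := Fin n) p (r := k + 1)
    hp1 hp0 (by simpa using hkn)
  rw [Fintype.card_fin] at hcheb
  have hsum := fun hM1 hM2 hr1 hr2 hrn hrx hE hA ↦ second_moment_sum_le (n := n) (r := k + 1)
    hp0 hp1 hel hl hlogL2 (by linarith) hn hnL rfl hM1 hM2 hr1 hr2 hrn hrx hE hA hB
  have hdiv : Real.log (qOf p) * (1 / 2 / Real.log (qOf p)) = 1 / 2 := by field_simp
  have hlow2 : Real.log (qOf p) * dominationLevel n p - 1 / 2 ≤ Real.log (qOf p) * k := by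
    have := mul_le_mul_of_nonneg_left hlow hl.le
    rw [mul_sub, hdiv] at this
    exact this
  have hup2 : Real.log (qOf p) * k ≤
      Real.log (qOf p) * dominationLevel n p + 1 / 2 + Real.log (qOf p) := by
    have := mul_le_mul_of_nonneg_left hup hl.le
    rw [mul_add, mul_add, hdiv, mul_one] at this
    exact this
  have hEsucc : Real.exp (Real.log (n * p)) / (4 * Real.log (n * p) ^ 2) ≤
      expectedDominating n (k + 1) p := by
    refine le_trans ?_ hsucc
    rw [← hnp]
    have hkn' : 2 * ((k : ℝ) + 1) ≤ n := by exact_mod_cast hkn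
    have hk0 : (0 : ℝ) < (k : ℝ) + 1 := by positivity
    have h1 : (n : ℝ) * p / (4 * Real.log (n * p)) ≤ (n - k) / (k + 1) := by
      rw [le_div_iff₀ hp0] at hk2
      rw [div_le_div_iff₀ (by positivity) hk0]
      calc (n : ℝ) * p * (k + 1) = n * ((k + 1) * p) := by ring
        _ ≤ n * (2 * Real.log (n * p)) := by gcongr
        _ = (n / 2) * (4 * Real.log (n * p)) := by ring
        _ ≤ _ := by gcongr; linarith
    calc (n : ℝ) * p / (4 * Real.log (n * p) ^ 2)
        = 1 / Real.log (n * p) * (n * p / (4 * Real.log (n * p))) := by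
          field_simp
      _ ≤ _ := mul_le_mul hmem h1 (by positivity) ((by positivity : (0 : ℝ) ≤ _).trans hmem)
  rw [expectedDominating] at hEsucc
  set x := (1 - (p : ℝ)) ^ (k + 1)
  set l := Real.log (qOf p)
  set L := Real.log (n * p)
  set ρ := dominationLevel n p
  set η := L ^ 4 / (n * (p : ℝ) ^ 2) with hηdef
  have hη0 : 0 ≤ η := by positivity
  push_cast at hM hk2
  have hhalf := exp_half_le_two
  -- The size `k + 1` lies between `ρ + 1 - 1/(2l)` and `ρ + 2 + 1/(2l)`. This gives the powers `1 -
  -- p` here and `(1 - p)²` in `hM2`, up to `e^{1/2} ≤ 2`.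
  have hM1 : n * x ≤ 2 * L ^ 2 * (1 - p) / l := by
    rw [hM]
    have : Real.exp (l * ρ - l * (k + 1)) ≤ 2 * (1 - p) := by
      calc Real.exp (l * ρ - l * (k + 1)) ≤ Real.exp (1 / 2 + -l) :=
            Real.exp_le_exp.2 (by linarith)
        _ ≤ 2 * (1 - p) := by
          rw [Real.exp_add, hel]
          gcongr
    calc L ^ 2 / l * Real.exp (l * ρ - l * (k + 1)) ≤ L ^ 2 / l * (2 * (1 - p)) := by gcongr
      _ = _ := by ring
  have hM2 : L ^ 2 * (1 - p) ^ 2 / (2 * l) ≤ n * x := by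
    rw [hM]
    have : (1 - (p : ℝ)) ^ 2 / 2 ≤ Real.exp (l * ρ - l * (k + 1)) := by
      calc (1 - (p : ℝ)) ^ 2 / 2 ≤ (1 - (p : ℝ)) ^ 2 / Real.exp (1 / 2) := by gcongr
        _ = Real.exp (-l + -l - 1 / 2) := by rw [Real.exp_sub, Real.exp_add, hel, sq]
        _ ≤ _ := Real.exp_le_exp.2 (by linarith)
    calc L ^ 2 * (1 - p) ^ 2 / (2 * l) = L ^ 2 / l * ((1 - (p : ℝ)) ^ 2 / 2) := by
          field_simp
      _ ≤ _ := by gcongr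
  have hMp : n * x ≤ 2 * L ^ 2 / p := by
    refine hM1.trans ?_
    calc 2 * L ^ 2 * (1 - p) / l ≤ 2 * L ^ 2 * 1 / p := by gcongr; linarith
      _ = _ := by ring
  have hrx : ((k : ℝ) + 1) * x ≤ 4 * η := by
    calc ((k : ℝ) + 1) * x = (k + 1) * (n * x) / n := by field_simp
      _ ≤ (2 * L / p) * (2 * L ^ 2 / p) / n := by gcongr
      _ = 4 * (L ^ 3 / (n * (p : ℝ) ^ 2)) := by field_simp; ring
      _ ≤ 4 * η := by
        rw [hηdef]
        gcongr
        · linarith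
        · norm_num
  -- Here `L⁴/(np²)` enters at full strength, which is what the lower bound on `p` is designed for.
  have hnx2 : n * x ^ 2 ≤ 4 * η := by
    calc n * x ^ 2 = (n * x) ^ 2 / n := by field_simp
      _ ≤ (2 * L ^ 2 / p) ^ 2 / n := by gcongr
      _ = 4 * η := by rw [hηdef]; field_simp; ring
  have hxhalf : x ≤ 1 / 2 := by
    have h1 : 1 * x ≤ ((k : ℝ) + 1) * x := by
      gcongr
      have : (0 : ℝ) ≤ k := by positivity
      linarith
    linarith
  have hA : 32 * L ^ 2 / (n * (p : ℝ) ^ 2) ≤ 32 * η := by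
    rw [hηdef, mul_div_assoc]
    gcongr
    · linarith
    · norm_num
  have hS := hsum hM1 hM2 (by push_cast; linarith) (by push_cast; exact hk2) (by omega)
    (by push_cast; linarith) hEsucc (by linarith)
  have hP := hcheb hxhalf
  have hκ : Real.exp (4 * ((k + 1 : ℕ) : ℝ) * x + 6 * n * x ^ 2) ≤ 1 + 80 * η := by
    have h1 : 4 * ((k + 1 : ℕ) : ℝ) * x + 6 * n * x ^ 2 ≤ 40 * η := by
      push_cast
      linarith
    refine (Real.exp_le_exp.2 h1).trans ?_
    have h2 := Real.abs_exp_sub_one_le (x := 40 * η) (by rw [abs_le]; constructor <;> linarith)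
    rw [abs_of_nonneg (by positivity : 0 ≤ 40 * η)] at h2
    have := (abs_le.1 h2).2
    linarith
  have hsecond : (SimpleGraph.binomialRandom (Fin n) p).real
      {G : SimpleGraph (Fin n) | k + 1 < G.dominationNumber} ≤
      272 * η + 54 * (L ^ 2 * Real.exp (-L / 2)) + 48 * (L ^ 2 * Real.exp (-L)) := by
    have hS2 := hS.trans (b := _) (c := 1 + (64 * η + 18 * (L ^ 2 * Real.exp (-L / 2)) +
      16 * (L ^ 2 * Real.exp (-L)))) (by linarith)
    set S := 64 * η + 18 * (L ^ 2 * Real.exp (-L / 2)) + 16 * (L ^ 2 * Real.exp (-L)) with hSdef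
    have hS0 : 0 ≤ S := by positivity
    refine hP.trans ?_
    have h1 := mul_le_mul hκ hS2 (Finset.sum_nonneg fun i _ ↦ by positivity) (by positivity)
    -- The total error is then `80η + 3S`, whence `272 = 80 + 3 · 64`, `54 = 3 · 18` and `48 = 3 ·
    -- 16`.
    have h2 : 80 * η * S ≤ 2 * S := by gcongr; linarith
    have h3 : (1 + 80 * η) * (1 + S) = 1 + 80 * η + S + 80 * η * S := by ring
    linarith
  calc _ ≤ _ := measureReal_mono hsub
    _ ≤ _ := measureReal_union_le _ _
    _ ≤ _ := add_le_add hfirst hsecond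
    _ = _ := by ring

/-! ### Asymptotics under the hypothesis on `p`. -/

section asymptotics

variable {p : ℕ → unitInterval}

theorem eventually_one_le_log : ∀ᶠ n : ℕ in atTop, 1 ≤ Real.log (n : ℝ) :=
  (Real.tendsto_log_atTop.comp tendsto_natCast_atTop_atTop).eventually_ge_atTop 1

/-- Eventually `p √n ≥ log² n ≥ 1`, so `np ≥ √n`: thus `log n` and `log (np)` agree up to a factor
2. -/
theorem eventually_pos_and_log_le
    (h : (fun n : ℕ => Real.log (n : ℝ) ^ 2 / Real.sqrt (n : ℝ))
      =o[atTop] (fun n : ℕ => (p n : ℝ))) :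
    ∀ᶠ n : ℕ in atTop, n ≠ 0 ∧ 0 < (p n : ℝ) ∧
      Real.log n ≤ 2 * Real.log (n * (p n : ℝ)) ∧ Real.log (n * (p n : ℝ)) ≤ Real.log n := by
  filter_upwards [h.bound one_pos, eventually_one_le_log, eventually_ne_atTop 0] with n h1 h2 h3
  have hn0 : (0 : ℝ) < n := by positivity
  have hs : 0 < Real.sqrt n := Real.sqrt_pos.2 hn0
  have hp0 : 0 ≤ (p n : ℝ) := (p n).2.1
  rw [one_mul, Real.norm_of_nonneg (by positivity), Real.norm_of_nonneg hp0,
    div_le_iff₀ hs] at h1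
  have h4 : 1 ≤ (p n : ℝ) * Real.sqrt n := by nlinarith
  have hpos : 0 < (p n : ℝ) := pos_of_mul_pos_left (by linarith) hs.le
  refine ⟨h3, hpos, ?_, ?_⟩
  · have h5 : Real.sqrt n ≤ n * p n := by
      calc Real.sqrt n = 1 * Real.sqrt n := (one_mul _).symm
        _ ≤ (p n * Real.sqrt n) * Real.sqrt n := by gcongr
        _ = n * p n := by rw [mul_assoc, Real.mul_self_sqrt hn0.le, mul_comm]
    have h6 := Real.log_le_log hs h5
    rw [Real.log_sqrt hn0.le] at h6
    linarith
  · refine Real.log_le_log (by positivity) ?_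
    exact mul_le_of_le_one_right hn0.le (p n).2.2

theorem tendsto_log_mul_atTop
    (h : (fun n : ℕ => Real.log (n : ℝ) ^ 2 / Real.sqrt (n : ℝ))
      =o[atTop] (fun n : ℕ => (p n : ℝ))) :
    Tendsto (fun n : ℕ ↦ Real.log (n * (p n : ℝ))) atTop atTop := by
  refine tendsto_atTop_mono' atTop (f₁ := fun n : ℕ ↦ Real.log (n : ℝ) / 2) ?_
    ((Real.tendsto_log_atTop.comp tendsto_natCast_atTop_atTop).atTop_div_const two_pos)
  filter_upwards [eventually_pos_and_log_le h] with n hn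
  linarith [hn.2.2.1]

/-- As `log (np) ≤ log n`, the quantity is dominated by the square of the ratio in the hypothesis.
-/
theorem tendsto_log_pow_div
    (h : (fun n : ℕ => Real.log (n : ℝ) ^ 2 / Real.sqrt (n : ℝ))
      =o[atTop] (fun n : ℕ => (p n : ℝ))) :
    Tendsto (fun n : ℕ ↦ Real.log (n * (p n : ℝ)) ^ 4 / (n * (p n : ℝ) ^ 2)) atTop (𝓝 0) := by
  have h1 := h.tendsto_div_nhds_zero.pow 2
  rw [zero_pow two_ne_zero] at h1
  refine squeeze_zero' ?_ ?_ h1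
  · filter_upwards with n
    positivity
  · filter_upwards [eventually_pos_and_log_le h, eventually_one_le_log] with n hn hlog
    obtain ⟨hn0, hp0, h2, h3⟩ := hn
    have hn0' : (0 : ℝ) < n := by positivity
    rw [div_pow, div_pow, Real.sq_sqrt hn0'.le, div_div, ← pow_mul]
    have : 0 ≤ Real.log (n * (p n : ℝ)) := by linarith
    gcongr

theorem eventually_log_le_mul {δ : ℝ} (hδ : 0 < δ) : ∀ᶠ L : ℝ in atTop, Real.log L ≤ δ * L := by
  filter_upwards [Real.isLittleO_log_id_atTop.bound hδ, eventually_ge_atTop 1] with L h1 h2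
  rw [id, Real.norm_of_nonneg (Real.log_nonneg h2), Real.norm_of_nonneg (by linarith)] at h1
  exact h1

theorem tendsto_sq_mul_exp_neg :
    Tendsto (fun L : ℝ ↦ L ^ 2 * Real.exp (-L)) atTop (𝓝 0) :=
  Real.tendsto_pow_mul_exp_neg_atTop_nhds_zero 2

theorem tendsto_sq_mul_exp_neg_half :
    Tendsto (fun L : ℝ ↦ L ^ 2 * Real.exp (-L / 2)) atTop (𝓝 0) := by
  have h := (tendsto_sq_mul_exp_neg.comp (tendsto_id.atTop_div_const two_pos)).const_mul 4
  rw [mul_zero] at h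
  refine h.congr fun L ↦ ?_
  simp only [Function.comp_apply, id]
  rw [neg_div]
  ring

theorem tendsto_log_qOf_mul_sub (hp1 : ∀ n, (p n : ℝ) < 1)
    (h : (fun n : ℕ => Real.log (n : ℝ) ^ 2 / Real.sqrt (n : ℝ))
      =o[atTop] (fun n : ℕ => (p n : ℝ))) :
    Tendsto (fun n : ℕ ↦ Real.log (qOf (p n)) *
      (dominationPoint n (p n) - dominationLevel n (p n))) atTop (𝓝 0) := by
  rw [Metric.tendsto_nhds]
  intro e he
  -- The localisation error is `δ + 1/(n+1)`, each part taking half of `e`.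
  set δ := min 1 (e / 2) with hδdef
  have hδ0 : 0 < δ := lt_min one_pos (by positivity)
  have hL := tendsto_log_mul_atTop h
  filter_upwards [eventually_pos_and_log_le h, hL.eventually_ge_atTop (64 / δ),
    hL.eventually (eventually_log_le_mul (δ := δ / 64) (by positivity)),
    (tendsto_sq_mul_exp_neg.comp hL).eventually_le_const (by positivity : 0 < δ / 8),
    tendsto_one_div_add_atTop_nhds_zero_nat.eventually_lt_const (by positivity : 0 < e / 2)]
    with n hn h1 h2 h3 h4
  obtain ⟨hn0, hp0, hnL, -⟩ := hn
  obtain ⟨-, -, -, hlow, hup, -, -⟩ := dominationThreshold_spec hn0 hp0 (hp1 n) hδ0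
    (min_le_left _ _) h1 (by linarith) h3 hnL
  have h5 := abs_dominationPoint_sub_le hp0 (hp1 n) hδ0.le hlow hup
  rw [Real.dist_eq, sub_zero]
  have : δ ≤ e / 2 := min_le_right _ _
  linarith

theorem tendsto_binomialRandom_real_compl_twoPointEvent (hp1 : ∀ n, (p n : ℝ) < 1)
    (h : (fun n : ℕ => Real.log (n : ℝ) ^ 2 / Real.sqrt (n : ℝ))
      =o[atTop] (fun n : ℕ => (p n : ℝ))) :
    Tendsto (fun n : ℕ ↦ (SimpleGraph.binomialRandom (Fin n) (p n)).real
      (twoPointEvent n (dominationPoint n (p n)))ᶜ) atTop (𝓝 0) := by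
  have hL := tendsto_log_mul_atTop h
  have hη := tendsto_log_pow_div h
  have hA := tendsto_sq_mul_exp_neg.comp hL
  have hB := tendsto_sq_mul_exp_neg_half.comp hL
  have hlim := (((tendsto_const_nhds (x := (1 : ℝ))).div_atTop hL).add (hη.const_mul 272)).add
    (hB.const_mul 54) |>.add (hA.const_mul 48)
  simp only [mul_zero, add_zero] at hlim
  refine squeeze_zero' (.of_forall fun n ↦ measureReal_nonneg) ?_ hlim
  filter_upwards [eventually_pos_and_log_le h, hL.eventually_ge_atTop 180,
    hL.eventually (eventually_log_le_mul (δ := 1 / 360) (by norm_num)),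
    hA.eventually_le_const (by norm_num : (0 : ℝ) < 1 / 16),
    hB.eventually_le_const (by norm_num : (0 : ℝ) < 1 / 18),
    hη.eventually_le_const (by norm_num : (0 : ℝ) < 1 / 64)] with n hn h1 h2 h3 h4 h5
  obtain ⟨hn0, hp0, hnL, -⟩ := hn
  simp only [Function.comp_apply] at h3 h4 ⊢
  exact binomialRandom_real_compl_twoPointEvent_le hn0 hp0 (hp1 n) (by linarith)
    (by linarith) h3 hnL h5 (by linarith)

end asymptotics

/-! ### The theorem. -/

theorem theorem1 :
    ∃ rhat : ℕ → ℝ → ℝ,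
      ∀ p : ℕ → unitInterval,
        (∀ n : ℕ, (p n : ℝ) < 1) →
        ((fun n : ℕ => Real.log (n : ℝ) ^ 2 / Real.sqrt (n : ℝ))
          =o[atTop] (fun n : ℕ => (p n : ℝ))) →
        (∃ ε : ℕ → ℝ, Tendsto ε atTop (𝓝 0) ∧
          ∀ᶠ n : ℕ in atTop,
            rhat n (p n) =
              Real.logb (qOf (p n))
                ((n : ℝ) * Real.log (qOf (p n)) / Real.log ((n : ℝ) * (p n : ℝ)) ^ 2
                  * (1 + ε n))) ∧
        Tendsto
          (fun n : ℕ => SimpleGraph.binomialRandom (Fin n) (p n) (twoPointEvent n (rhat n (p n))))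
          atTop (𝓝 1) := by
  -- This `ε` is obtained by solving the required formula, which therefore holds exactly; only `ε →
  -- 0` needs the localisation of the threshold.
  refine ⟨dominationPoint, fun p hp1 h ↦ ⟨⟨fun n ↦ Real.exp (Real.log (qOf (p n)) *
      (dominationPoint n (p n) - dominationLevel n (p n))) - 1, ?_, ?_⟩, ?_⟩⟩
  · have h1 := (Real.continuous_exp.tendsto 0).comp (tendsto_log_qOf_mul_sub hp1 h)
    simpa using h1.sub_const 1
  · filter_upwards [eventually_pos_and_log_le h,
      (tendsto_log_mul_atTop h).eventually_gt_atTop 0] with n hn hL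
    obtain ⟨hn0, hp0, -, -⟩ := hn
    have hn0' : (0 : ℝ) < n := by positivity
    have hl := log_qOf_pos hp0 (hp1 n)
    have hlev := mul_dominationLevel (n := n) hp0 (hp1 n)
    rw [add_sub_cancel, Real.logb, eq_div_iff hl.ne', Real.log_mul (by positivity)
      (Real.exp_pos _).ne', Real.log_exp, Real.log_div (by positivity) (by positivity),
      Real.log_mul hn0'.ne' hl.ne', Real.log_pow]
    push_cast
    linarith
  · have h1 := (tendsto_binomialRandom_real_compl_twoPointEvent hp1 h).const_sub 1
    rw [sub_zero] at h1
    have h2 := ENNReal.tendsto_ofReal h1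
    rw [ENNReal.ofReal_one] at h2
    refine h2.congr fun n ↦ ?_
    rw [probReal_compl_eq_one_sub MeasurableSet.of_discrete, sub_sub_cancel, ofReal_measureReal]
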